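/- Let $\mathcal{M}_{m,n}$ denote the real $m\times n$ matrices and let a signed permutation matrix be a permutation matrix multiplied by a diagonal matrix with entries $\pm1$. A random matrix $Y\in\mathcal{M}_{m,n}$ is called SPM-bi-invariant if $Q_mY$ and $YQ_n$ have the same distribution as $Y$ for all signed permutation matrices $Q_m$ of size $m$ and $Q_n$ of size $n$. For $A\in\mathcal{M}_{s,k}$ and $B\in\mathcal{M}_{t,k}$ put $$p_{A,B}(x,y,z)=\det\bigl(xI+yA^{\top}A+zB^{\top}B\bigr),\qquad q_{A,B}(x,y,z)=y^{s}z^{t}\,p_{A,B}(x,1/y,1/z),$$ where $q_{A,B}$ is a polynomial in $x,y,z$. Let $s,t,k\ge 0$ be integers, let $\theta_1,\theta_2\in\mathbb{R}$, and let $\{A_i\}_{i\ge1}\subseteq\mathcal{M}_{s,k}$ and $\{B_i\}_{i\ge1}\subseteq\mathcal{M}_{t,k}$ be sequences of SPM-bi-invariant random matrices, all of the $A_i$ and $B_j$ being mutually independent. Assume that the entries have all moments bounded, i.e. for every $r\in\mathbb{N}$ the absolute moments of order $r$ of the entries of $A_i$ and of $B_i$ are finite and bounded uniformly in $i$, and that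 for all $i$ $$\mathbb{E}\bigl[\operatorname{tr}(A_iA_i^{\top})\bigr]=\theta_1 sk,\qquad \mathbb{E}\bigl[\operatorname{tr}(B_iB_i^{\top})\bigr]=\theta_2 tk .$$ Define $$C_m=\frac{1}{\sqrt m}\sum_{i=1}^{m}A_i,\qquad D_m=\frac{1}{\sqrt m}\sum_{i=1}^{m}B_i .$$ Then the expectations below are finite and $$\lim_{m\to\infty}\mathbb{E}\bigl[q_{C_m,D_m}(x,y,z)\bigr]=e^{\theta_1\partial_x\partial_y+\theta_2\partial_x\partial_z}\bigl\{x^{k}y^{s}z^{t}\bigr\},\qquad e^{L}=\sum_{i\ge0}\frac{L^{i}}{i!},$$ where the convergence holds coefficient by coefficient and at every point $(x,y,z)\in\mathbb{R}^3$. -/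

import Mathlib

open MeasureTheory ProbabilityTheory Filter Topology

/-- The Borel (product) sigma-algebra on the real `m × n` matrices. -/
instance Matrix.instMeasurableSpaceReal {m n : ℕ} :
    MeasurableSpace (Matrix (Fin m) (Fin n) ℝ) :=
  inferInstanceAs (MeasurableSpace (Fin m → Fin n → ℝ))

namespace SPMCLT

/-! ### Signed permutation matrices and bi-invariance -/

/-- The set of `n × n` signed permutation matrices. -/
def signedPerm (n : ℕ) : Set (Matrix (Fin n) (Fin n) ℝ) :=
  {Q | ∃ (σ : Equiv.Perm (Fin n)) (ε : Fin n → ℝ), (∀ i, ε i = 1 ∨ ε i = -1) ∧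
    Q = Matrix.diagonal ε * σ.permMatrix ℝ}

/-- A random matrix `Y` is SPM-bi-invariant if `Q Y` and `Y R` have the law of `Y` for all
signed permutation matrices `Q`, `R` of the appropriate sizes. -/
def SPMBiInvariant {Ω : Type*} [MeasurableSpace Ω] (μ : Measure Ω) {m n : ℕ}
    (Y : Ω → Matrix (Fin m) (Fin n) ℝ) : Prop :=
  (∀ Q ∈ signedPerm m, IdentDistrib (fun ω => Q * Y ω) Y μ μ) ∧
  (∀ R ∈ signedPerm n, IdentDistrib (fun ω => Y ω * R) Y μ μ)

/-- All absolute moments of the entries of the matrices `A i` are finite, and for each order they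
are bounded uniformly in `i`. -/
def BoundedMoments {Ω : Type*} [MeasurableSpace Ω] (μ : Measure Ω) {m n : ℕ}
    (A : ℕ → Ω → Matrix (Fin m) (Fin n) ℝ) : Prop :=
  ∀ r : ℕ, ∃ M : ℝ, ∀ i a b,
    Integrable (fun ω => |A i ω a b| ^ r) μ ∧ ∫ ω, |A i ω a b| ^ r ∂μ ≤ M

/-- All the random matrices `A 0, B 0, A 1, B 1, …` are mutually independent. -/
def JointlyIndependent {Ω : Type*} [MeasurableSpace Ω] (μ : Measure Ω) {s t k : ℕ}
    (A : ℕ → Ω → Matrix (Fin s) (Fin k) ℝ) (B : ℕ → Ω → Matrix (Fin t) (Fin k) ℝ) : Prop :=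
  iIndep (Sum.elim (fun i : ℕ => MeasurableSpace.comap (A i) inferInstance)
    (fun i : ℕ => MeasurableSpace.comap (B i) inferInstance)) μ

/-- The normalized sum `(A 0 + ⋯ + A (m - 1)) / √m`. -/
noncomputable def normalizedSum {Ω : Type*} {a b : ℕ} (A : ℕ → Ω → Matrix (Fin a) (Fin b) ℝ)
    (m : ℕ) (ω : Ω) : Matrix (Fin a) (Fin b) ℝ :=
  (Real.sqrt m)⁻¹ • ∑ i ∈ Finset.range m, A i ω

/-! ### The polynomials; the variables `x, y, z` are `X 0, X 1, X 2` -/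

/-- `p_{A,B}(x,y,z) = det (x I + y AᵀA + z BᵀB)`. -/
noncomputable def pPoly {s t k : ℕ} (A : Matrix (Fin s) (Fin k) ℝ)
    (B : Matrix (Fin t) (Fin k) ℝ) : MvPolynomial (Fin 3) ℝ :=
  Matrix.det ((MvPolynomial.X 0 : MvPolynomial (Fin 3) ℝ) •
      (1 : Matrix (Fin k) (Fin k) (MvPolynomial (Fin 3) ℝ))
    + (MvPolynomial.X 1 : MvPolynomial (Fin 3) ℝ) • (A.transpose * A).map MvPolynomial.C
    + (MvPolynomial.X 2 : MvPolynomial (Fin 3) ℝ) • (B.transpose * B).map MvPolynomial.C)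

theorem eval_pPoly {s t k : ℕ} (A : Matrix (Fin s) (Fin k) ℝ)
    (B : Matrix (Fin t) (Fin k) ℝ) (x y z : ℝ) :
    MvPolynomial.eval ![x, y, z] (pPoly A B) =
      Matrix.det (x • (1 : Matrix (Fin k) (Fin k) ℝ) + y • (A.transpose * A)
        + z • (B.transpose * B)) := by
  rw [pPoly, RingHom.map_det]
  congr 1
  ext i j
  by_cases h : i = j <;> simp [h, -Matrix.map_mul]

/-- A polynomial in `x, y, z` is determined by its values at points with `y, z ≠ 0`. -/
theorem poly_ext {p q : MvPolynomial (Fin 3) ℝ}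
    (h : ∀ x y z : ℝ, y ≠ 0 → z ≠ 0 →
      MvPolynomial.eval ![x, y, z] p = MvPolynomial.eval ![x, y, z] q) : p = q := by
  have hX : (MvPolynomial.X 1 * MvPolynomial.X 2 : MvPolynomial (Fin 3) ℝ) ≠ 0 :=
    mul_ne_zero (MvPolynomial.X_ne_zero 1) (MvPolynomial.X_ne_zero 2)
  apply mul_left_cancel₀ hX
  apply MvPolynomial.funext
  intro v
  have hv : v = ![v 0, v 1, v 2] := by
    ext i; fin_cases i <;> rfl
  simp only [map_mul, MvPolynomial.eval_X]
  by_cases h1 : v 1 = 0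
  · simp [h1]
  by_cases h2 : v 2 = 0
  · simp [h2]
  have := h (v 0) (v 1) (v 2) h1 h2
  rw [← hv] at this
  rw [this]

/-- `yˢ zᵗ p_{A,B}(x, 1/y, 1/z)` is a polynomial. -/
theorem existsUnique_qPoly {s t k : ℕ} (A : Matrix (Fin s) (Fin k) ℝ)
    (B : Matrix (Fin t) (Fin k) ℝ) :
    ∃! q : MvPolynomial (Fin 3) ℝ, ∀ x y z : ℝ, y ≠ 0 → z ≠ 0 →
      MvPolynomial.eval ![x, y, z] q =
        y ^ s * z ^ t * MvPolynomial.eval ![x, 1 / y, 1 / z] (pPoly A B) := by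
  let P := MvPolynomial (Fin 3) ℝ
  let q : P := Matrix.det (Matrix.fromBlocks
    ((MvPolynomial.X 0 : P) • (1 : Matrix (Fin k) (Fin k) P))
    (-(Matrix.fromRows A B).transpose.map MvPolynomial.C)
    ((Matrix.fromRows A B).map MvPolynomial.C)
    (Matrix.diagonal (Sum.elim (fun _ => (MvPolynomial.X 1 : P)) (fun _ => MvPolynomial.X 2))))
  have hq : ∀ x y z : ℝ, y ≠ 0 → z ≠ 0 → MvPolynomial.eval ![x, y, z] q =
      y ^ s * z ^ t * MvPolynomial.eval ![x, 1 / y, 1 / z] (pPoly A B) := by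
    intro x y z hy hz
    have e1 : MvPolynomial.eval ![x, y, z] q = Matrix.det (Matrix.fromBlocks
        (x • (1 : Matrix (Fin k) (Fin k) ℝ)) (-(Matrix.fromRows A B).transpose)
        (Matrix.fromRows A B)
        (Matrix.diagonal (Sum.elim (fun _ : Fin s => y) (fun _ : Fin t => z)))) := by
      rw [RingHom.map_det]
      congr 1
      ext (i | i) (j | j)
      · by_cases h : i = j <;> simp [h]
      · simp
      · simp
      · by_cases h : i = j
        · subst h; rcases i with i | i <;> simp
        · simp [h]
    have hinv : Matrix.diagonal (Sum.elim (fun _ : Fin s => y⁻¹) (fun _ : Fin t => z⁻¹)) *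
        Matrix.diagonal (Sum.elim (fun _ : Fin s => y) (fun _ : Fin t => z)) = 1 := by
      rw [Matrix.diagonal_mul_diagonal, ← Matrix.diagonal_one]
      congr 1
      ext (i | i) <;> simp [hy, hz]
    let I : Invertible (Matrix.diagonal (Sum.elim (fun _ : Fin s => y) (fun _ : Fin t => z))) :=
      ⟨_, hinv, mul_eq_one_comm.1 hinv⟩
    have hI : ⅟(Matrix.diagonal (Sum.elim (fun _ : Fin s => y) (fun _ : Fin t => z))) =
      Matrix.diagonal (Sum.elim (fun _ : Fin s => y⁻¹) (fun _ : Fin t => z⁻¹)) := rfl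
    rw [e1, Matrix.det_fromBlocks₂₂, hI, eval_pPoly, Matrix.det_diagonal]
    congr 1
    · simp [Fintype.prod_sum_type]
    · congr 1
      ext i j
      simp [Matrix.mul_apply, Fintype.sum_sum_type, Matrix.diagonal_apply, Finset.mul_sum]
      simp only [mul_comm (A _ _) y⁻¹, mul_comm (B _ _) z⁻¹]
      ring_nf
  exact ⟨q, hq, fun q' hq' => poly_ext fun x y z hy hz => by
    rw [hq x y z hy hz, hq' x y z hy hz]⟩

/-- `q_{A,B}(x,y,z) = yˢ zᵗ p_{A,B}(x, 1/y, 1/z)`, as a polynomial. -/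
noncomputable def qPoly {s t k : ℕ} (A : Matrix (Fin s) (Fin k) ℝ)
    (B : Matrix (Fin t) (Fin k) ℝ) : MvPolynomial (Fin 3) ℝ :=
  Classical.choose (existsUnique_qPoly A B).exists

theorem eval_qPoly {s t k : ℕ} (A : Matrix (Fin s) (Fin k) ℝ)
    (B : Matrix (Fin t) (Fin k) ℝ) (x y z : ℝ) (hy : y ≠ 0) (hz : z ≠ 0) :
    MvPolynomial.eval ![x, y, z] (qPoly A B) =
      y ^ s * z ^ t * MvPolynomial.eval ![x, 1 / y, 1 / z] (pPoly A B) :=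
  Classical.choose_spec (existsUnique_qPoly A B).exists x y z hy hz

/-- The random polynomial `q_{C_m, D_m}`. -/
noncomputable def qSum {Ω : Type*} {s t k : ℕ} (A : ℕ → Ω → Matrix (Fin s) (Fin k) ℝ)
    (B : ℕ → Ω → Matrix (Fin t) (Fin k) ℝ) (m : ℕ) (ω : Ω) : MvPolynomial (Fin 3) ℝ :=
  qPoly (normalizedSum A m ω) (normalizedSum B m ω)

/-! ### The exponential of the differential operator -/

/-- The operator `θ₁ ∂x ∂y + θ₂ ∂x ∂z` on real polynomials in `x, y, z`. -/
noncomputable def diffOp (θ₁ θ₂ : ℝ) : Module.End ℝ (MvPolynomial (Fin 3) ℝ) :=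
  θ₁ • ((MvPolynomial.pderiv 0).toLinearMap * (MvPolynomial.pderiv 1).toLinearMap)
    + θ₂ • ((MvPolynomial.pderiv 0).toLinearMap * (MvPolynomial.pderiv 2).toLinearMap)

/-- `e^L p = ∑ i, Lⁱ p / i!`, for an operator `L` with `Lⁱ p = 0` for all large `i`. -/
noncomputable def expOp (L : Module.End ℝ (MvPolynomial (Fin 3) ℝ))
    (p : MvPolynomial (Fin 3) ℝ) : MvPolynomial (Fin 3) ℝ :=
  ∑ᶠ i : ℕ, ((i.factorial : ℝ)⁻¹) • (L ^ i) p

/-- The polynomial `e^{θ₁ ∂x ∂y + θ₂ ∂x ∂z} xᵏ yˢ zᵗ`. -/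
noncomputable def limitPoly (s t k : ℕ) (θ₁ θ₂ : ℝ) : MvPolynomial (Fin 3) ℝ :=
  expOp (diffOp θ₁ θ₂)
    (MvPolynomial.X 0 ^ k * MvPolynomial.X 1 ^ s * MvPolynomial.X 2 ^ t)

theorem diffOp_isHomogeneous (θ₁ θ₂ : ℝ) (n : ℕ) {p : MvPolynomial (Fin 3) ℝ}
    (hp : p.IsHomogeneous n) : (diffOp θ₁ θ₂ p).IsHomogeneous (n - 1 - 1) := by
  have h (θ : ℝ) (i : Fin 3) :
      (θ • MvPolynomial.pderiv 0 (MvPolynomial.pderiv i p)).IsHomogeneous (n - 1 - 1) := by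
    rw [MvPolynomial.smul_eq_C_mul]
    simpa using (MvPolynomial.isHomogeneous_C (Fin 3) θ).mul (hp.pderiv (i := i)).pderiv
  exact (h θ₁ 1).add (h θ₂ 2)

theorem diffOp_pow_eq_zero (θ₁ θ₂ : ℝ) (n : ℕ) : ∀ (p : MvPolynomial (Fin 3) ℝ) (d : ℕ),
    p.IsHomogeneous d → d < n → ((diffOp θ₁ θ₂) ^ n) p = 0 := by
  induction n with
  | zero => intro p d _ h; omega
  | succ n ih =>
    intro p d hp hd
    rw [pow_succ, Module.End.mul_apply]
    rcases Nat.eq_zero_or_pos d with rfl | hd0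
    · have : p = MvPolynomial.C (p.coeff 0) :=
        MvPolynomial.totalDegree_eq_zero_iff_eq_C.1
          (Nat.le_zero.1 hp.totalDegree_le)
      have h0 : diffOp θ₁ θ₂ p = 0 := by
        rw [this]; simp [diffOp]
      rw [h0, map_zero]
    · exact ih _ _ (diffOp_isHomogeneous θ₁ θ₂ d hp) (by omega)

/-- The series defining `e^{θ₁ ∂x ∂y + θ₂ ∂x ∂z} p` has finitely many nonzero terms. -/
theorem expOp_diffOp (θ₁ θ₂ : ℝ) (p : MvPolynomial (Fin 3) ℝ) :
    expOp (diffOp θ₁ θ₂) p = ∑ i ∈ Finset.range (p.totalDegree + 1),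
      ((i.factorial : ℝ)⁻¹) • ((diffOp θ₁ θ₂) ^ i) p := by
  apply finsum_eq_sum_of_support_subset
  intro i hi
  by_contra hc
  apply hi
  simp only [Finset.coe_range, Set.mem_Iio, not_lt] at hc
  have : ((diffOp θ₁ θ₂) ^ i) p = 0 := by
    conv_lhs => rw [← MvPolynomial.sum_homogeneousComponent p]
    rw [map_sum]
    refine Finset.sum_eq_zero fun d hd => diffOp_pow_eq_zero θ₁ θ₂ i _ d
      (MvPolynomial.homogeneousComponent_isHomogeneous d p) ?_
    have := Finset.mem_range.1 hd
    omega
  simp [this]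

end SPMCLT

/-!
The proof is a Lindeberg-type central limit theorem for operator exponentials, combined with a heat
equation for the determinant that defines `q_{A,B}`.

Let `M` be the matrix `A` stacked on top of `B`. By a Schur complement (`subst_genDet`), `q_{A,B}`
is the determinant of the block matrix `[[x I, -Mᵀ], [M, diag (y, …, y, z, …, z)]]`. Taking the entries
of `M` as additional variables gives one polynomial `genDet` of total degree at most `k + s + t`. By
Taylor's formula (`subst_eq_sum_dirDeriv`), `q_{A,B}` is the value at `M = 0` of
`exp (∑ M a b • ∂_{a b}) genDet`. The operators `∂_{a b}` commute and act nilpotently on the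
finite-dimensional space of polynomials of bounded degree, so the exponentials live in a Banach
algebra and are polynomials in the entries of `M`.

Since the `∂_{a b}` commute and the matrices are independent, the expectation of the exponential for
`C_m` is a product of `m` factors. Sign changes and permutations of the rows and columns show that
the entries of each `A i` are centred, uncorrelated and of variance `θ₁`
(`SPMBiInvariant.integral_mul`), so that each factor is `1 + L / m + O(m⁻³ᐟ²)` with
`L = (θ₁ / 2) ∑ ∂_{a b}²`, and the product converges to `exp L`
(`tendsto_integral_exp_normalized_sum`). The matrices `B i` are treated in the same way.

It remains to evaluate the heat flow `exp L` on `genDet`. A determinant is affine in each row, which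
gives `½ ∂_{a b}² genDet = ∂_{x_b} ∂_{y_a} genDet` if the diagonal entries are regarded as distinct
variables: both sides are the minor without the rows and columns of `a` and `b`. Summation yields
`L genDet = (θ₁ ∂x ∂y + θ₂ ∂x ∂z) genDet` (`entryLaplacian_genDet`). The two operators commute,
hence their exponentials agree on `genDet`, and at `M = 0` the determinant is `x ^ k y ^ s z ^ t`.
-/

namespace SPMCLT

/-! ### A central limit theorem for exponentials in a Banach algebra -/

/-- Telescoping comparison of a product `a 0 * a 1 * ⋯ * a (m - 1)` with the power `b ^ m`. -/
theorem norm_prod_sub_pow_le {𝔸 : Type*} [NormedRing 𝔸] [NormOneClass 𝔸] {P a : ℕ → 𝔸} {b : 𝔸}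
    {δ R : ℝ} {m : ℕ} (hP0 : P 0 = 1) (hP : ∀ j, P (j + 1) = P j * a j)
    (hR : 1 ≤ R) (hδ : 0 ≤ δ) (hab : ∀ j < m, ‖a j - b‖ ≤ δ) (ha : ∀ j < m, ‖a j‖ ≤ R)
    (hb : ‖b‖ ≤ R) : ‖P m - b ^ m‖ ≤ m * δ * R ^ m := by
  induction m with
  | zero => simp [hP0]
  | succ m ih =>
    have ih := ih (fun j hj => hab j (by omega)) (fun j hj => ha j (by omega))
    have hR0 : (0 : ℝ) ≤ R := zero_le_one.trans hR
    have hbm : ‖b ^ m‖ ≤ R ^ m := (norm_pow_le b m).trans (pow_le_pow_left₀ (norm_nonneg _) hb m)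
    calc ‖P (m + 1) - b ^ (m + 1)‖ = ‖(P m - b ^ m) * a m + b ^ m * (a m - b)‖ := by
          rw [hP, pow_succ]; congr 1; noncomm_ring
      _ ≤ ‖P m - b ^ m‖ * ‖a m‖ + ‖b ^ m‖ * ‖a m - b‖ :=
          (norm_add_le _ _).trans (add_le_add (norm_mul_le _ _) (norm_mul_le _ _))
      _ ≤ (m * δ * R ^ m) * R + R ^ m * δ :=
          add_le_add
            (mul_le_mul ih (ha m (by omega)) (norm_nonneg _) (by positivity))
            (mul_le_mul hbm (hab m (by omega)) (norm_nonneg _) (by positivity))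
      _ ≤ (m * δ * R ^ m) * R + R ^ m * δ * R := by
          exact (add_le_add_iff_left _).2 (le_mul_of_one_le_right (by positivity) hR)
      _ = ((m + 1 : ℕ) : ℝ) * δ * R ^ (m + 1) := by push_cast; ring

theorem exp_eq_sum_of_pow_eq_zero {𝔸 : Type*} [NormedRing 𝔸] [NormedAlgebra ℝ 𝔸] {a : 𝔸} {n : ℕ}
    (ha : a ^ n = 0) :
    NormedSpace.exp a = ∑ j ∈ Finset.range n, ((j.factorial : ℝ)⁻¹) • a ^ j := by
  rw [NormedSpace.exp_eq_tsum ℝ]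
  apply tsum_eq_sum
  intro j hj
  rw [pow_eq_zero_of_le (by simpa using hj) ha, smul_zero]

section Integrals

variable {Ω : Type*} [MeasurableSpace Ω] {μ : Measure Ω}
  {𝔸 : Type*} [NormedRing 𝔸] [MeasurableSpace 𝔸] [BorelSpace 𝔸]

theorem integrable_pow_of_norm [SecondCountableTopology 𝔸] {Y : Ω → 𝔸}
    (hY : Measurable Y) {j : ℕ} (hj : 0 < j)
    (h : Integrable (fun ω => ‖Y ω‖ ^ j) μ) : Integrable (fun ω => Y ω ^ j) μ :=
  h.mono' (hY.pow_const j).aestronglyMeasurable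
    (ae_of_all _ fun _ => norm_pow_le' _ hj)

theorem integrable_exp_smul_of_nilpotent [NormedAlgebra ℝ 𝔸] [CompleteSpace 𝔸]
    [SecondCountableTopology 𝔸] [IsProbabilityMeasure μ] {Y : Ω → 𝔸} (hY : Measurable Y)
    {n : ℕ} (hnil : ∀ ω, Y ω ^ n = 0) (hmom : ∀ j < n, Integrable (fun ω => ‖Y ω‖ ^ j) μ) (h : ℝ) :
    Integrable (fun ω => NormedSpace.exp (h • Y ω)) μ := by
  have he : (fun ω => NormedSpace.exp (h • Y ω)) = fun ω =>
      ∑ j ∈ Finset.range n, ((j.factorial : ℝ)⁻¹ * h ^ j) • Y ω ^ j := by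
    funext ω
    rw [exp_eq_sum_of_pow_eq_zero (n := n) (by rw [smul_pow, hnil, smul_zero])]
    simp only [smul_pow, smul_smul]
  rw [he]
  refine integrable_finsetSum _ fun j hj => ?_
  suffices Integrable (fun ω => Y ω ^ j) μ from this.smul ((j.factorial : ℝ)⁻¹ * h ^ j)
  rcases Nat.eq_zero_or_pos j with rfl | hj0
  · simp
  · exact integrable_pow_of_norm hY hj0 (hmom j (Finset.mem_range.1 hj))

/-- Second order expansion of the expected exponential of a small centred nilpotent element. The
exponent `n + 3` of nilpotency makes the terms of order at most two always present in the sum. -/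
theorem norm_integral_exp_smul_sub_le [NormedAlgebra ℝ 𝔸] [CompleteSpace 𝔸]
    [SecondCountableTopology 𝔸] [IsProbabilityMeasure μ] {Y : Ω → 𝔸} (hY : Measurable Y)
    {n : ℕ} (hnil : ∀ ω, Y ω ^ (n + 3) = 0) {K : ℝ}
    (hmom : ∀ j < n + 3, Integrable (fun ω => ‖Y ω‖ ^ j) μ ∧ ∫ ω, ‖Y ω‖ ^ j ∂μ ≤ K)
    (hmean : ∫ ω, Y ω ∂μ = 0) {L : 𝔸} (hvar : ∫ ω, Y ω ^ 2 ∂μ = (2 : ℝ) • L)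
    {h : ℝ} (h0 : 0 ≤ h) (h1 : h ≤ 1) :
    ‖∫ ω, NormedSpace.exp (h • Y ω) ∂μ - (1 + h ^ 2 • L)‖ ≤ h ^ 3 * (n * K) := by
  have hint (j : ℕ) (hj : j < n + 3) (hj0 : 0 < j) : Integrable (fun ω => Y ω ^ j) μ :=
    integrable_pow_of_norm hY hj0 (hmom j hj).1
  have he (ω : Ω) : NormedSpace.exp (h • Y ω) = (1 + h • Y ω + (h ^ 2 / 2) • Y ω ^ 2) +
      ∑ j ∈ Finset.range n, (((j + 3).factorial : ℝ)⁻¹ * h ^ (j + 3)) • Y ω ^ (j + 3) := by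
    rw [exp_eq_sum_of_pow_eq_zero (n := n + 3) (by rw [smul_pow, hnil, smul_zero]),
      add_comm n 3, Finset.sum_range_add]
    congr 1
    · simp [Finset.sum_range_succ, smul_pow, smul_smul]
      ring_nf
    · simp only [smul_pow, smul_smul, add_comm 3]
  have i1 : Integrable (fun ω => h • Y ω) μ := by
    have h1 := hint 1 (by omega) one_pos
    simp only [pow_one] at h1
    exact h1.smul h
  have i2 : Integrable (fun ω => (h ^ 2 / 2) • Y ω ^ 2) μ :=
    (hint 2 (by omega) two_pos).smul (h ^ 2 / 2)
  have i3 (j : ℕ) (hj : j ∈ Finset.range n) :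
      Integrable (fun ω => (((j + 3).factorial : ℝ)⁻¹ * h ^ (j + 3)) • Y ω ^ (j + 3)) μ :=
    (hint (j + 3) (by have := Finset.mem_range.1 hj; omega) (by omega)).smul
      (((j + 3).factorial : ℝ)⁻¹ * h ^ (j + 3))
  have i0 : Integrable (fun _ : Ω => (1 : 𝔸)) μ := integrable_const _
  have i01 : Integrable (fun ω => 1 + h • Y ω) μ := i0.add i1
  have i02 : Integrable (fun ω => 1 + h • Y ω + (h ^ 2 / 2) • Y ω ^ 2) μ := i01.add i2
  have hmain : ∫ ω, NormedSpace.exp (h • Y ω) ∂μ - (1 + h ^ 2 • L) =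
      ∑ j ∈ Finset.range n, (((j + 3).factorial : ℝ)⁻¹ * h ^ (j + 3)) • ∫ ω, Y ω ^ (j + 3) ∂μ := by
    simp_rw [he]
    rw [integral_add i02 (integrable_finsetSum _ i3),
      integral_add i01 i2, integral_add i0 i1, integral_finsetSum _ i3]
    simp only [integral_smul, hmean, hvar, smul_smul, integral_const, probReal_univ, one_smul,
      smul_zero, add_zero]
    rw [div_mul_cancel₀ _ two_ne_zero, add_sub_cancel_left]
  have hK (j : ℕ) (hj : j < n + 3) (hj0 : 0 < j) : ‖∫ ω, Y ω ^ j ∂μ‖ ≤ K :=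
    (norm_integral_le_of_norm_le (hmom j hj).1
      (ae_of_all _ fun ω => norm_pow_le' _ hj0)).trans (hmom j hj).2
  rw [hmain]
  calc _ ≤ ∑ j ∈ Finset.range n, h ^ 3 * K := by
        refine norm_sum_le_of_le _ fun j hj => ?_
        rw [norm_smul, Real.norm_of_nonneg (by positivity)]
        have hf : ((j + 3).factorial : ℝ)⁻¹ ≤ 1 :=
          inv_le_one_of_one_le₀ (by exact_mod_cast (j + 3).factorial_pos)
        have hp : h ^ (j + 3) ≤ h ^ 3 := pow_le_pow_of_le_one h0 h1 (by omega)
        have : ((j + 3).factorial : ℝ)⁻¹ * h ^ (j + 3) ≤ h ^ 3 :=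
          (mul_le_of_le_one_left (by positivity) hf).trans hp
        exact mul_le_mul this
          (hK (j + 3) (by have := Finset.mem_range.1 hj; omega) (by omega))
          (norm_nonneg _) (by positivity)
    _ = h ^ 3 * (n * K) := by rw [Finset.sum_const, Finset.card_range, nsmul_eq_mul]; ring

theorem integrable_mul_and_integral_mul_of_indepFun [NormedAlgebra ℝ 𝔸] [CompleteSpace 𝔸]
    {X Y : Ω → 𝔸} (hXY : IndepFun X Y μ)
    (hX : Integrable X μ) (hY : Integrable Y μ) :
    Integrable (fun ω => X ω * Y ω) μ ∧
      ∫ ω, X ω * Y ω ∂μ = (∫ ω, X ω ∂μ) * ∫ ω, Y ω ∂μ :=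
  ⟨hXY.integrable_bilin hX hY (ContinuousLinearMap.mul ℝ 𝔸),
    hXY.integral_bilin hX hY (ContinuousLinearMap.mul ℝ 𝔸)⟩

/-- For commuting independent elements, `E exp (h ∑ Y i)` is built up one factor at a time. -/
theorem integral_exp_smul_sum_succ [NormedAlgebra ℝ 𝔸] [CompleteSpace 𝔸]
    [SecondCountableTopology 𝔸] [IsProbabilityMeasure μ] {Y : ℕ → Ω → 𝔸}
    (hY : ∀ i, Measurable (Y i)) (hindep : iIndepFun Y μ)
    (hcomm : ∀ i j ω ω', Commute (Y i ω) (Y j ω')) {h : ℝ}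
    (hint : ∀ i, Integrable (fun ω => NormedSpace.exp (h • Y i ω)) μ) (m : ℕ) :
    Integrable (fun ω => NormedSpace.exp (h • ∑ i ∈ Finset.range m, Y i ω)) μ ∧
    ∫ ω, NormedSpace.exp (h • ∑ i ∈ Finset.range (m + 1), Y i ω) ∂μ =
      (∫ ω, NormedSpace.exp (h • ∑ i ∈ Finset.range m, Y i ω) ∂μ) *
        ∫ ω, NormedSpace.exp (h • Y m ω) ∂μ := by
  let +nondep : NormedAlgebra ℚ 𝔸 := NormedAlgebra.restrictScalars ℚ ℝ 𝔸
  have he (m : ℕ) : (fun ω => NormedSpace.exp (h • ∑ i ∈ Finset.range (m + 1), Y i ω)) = fun ω =>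
      NormedSpace.exp (h • ∑ i ∈ Finset.range m, Y i ω) * NormedSpace.exp (h • Y m ω) := by
    funext ω
    rw [Finset.sum_range_succ, smul_add, NormedSpace.exp_add_of_commute]
    exact ((Commute.sum_left _ _ _ fun i _ => hcomm i m ω ω).smul_left h).smul_right h
  have hexp : Measurable fun a : 𝔸 => NormedSpace.exp (h • a) :=
    (NormedSpace.exp_continuous.comp (continuous_const_smul h)).measurable
  have hind (m : ℕ) : IndepFun (fun ω => NormedSpace.exp (h • ∑ i ∈ Finset.range m, Y i ω))
      (fun ω => NormedSpace.exp (h • Y m ω)) μ := by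
    have := (hindep.indepFun_finsetSum_of_notMem hY
      (Finset.notMem_range_self (n := m))).comp hexp hexp
    simpa [Function.comp_def, Finset.sum_apply] using this
  have hI : Integrable (fun ω => NormedSpace.exp (h • ∑ i ∈ Finset.range m, Y i ω)) μ := by
    induction m with
    | zero => simp
    | succ m ih =>
      rw [he]
      exact (integrable_mul_and_integral_mul_of_indepFun (hind m) ih (hint m)).1
  refine ⟨hI, ?_⟩
  rw [he]
  exact (integrable_mul_and_integral_mul_of_indepFun (hind m) hI (hint m)).2

/-- The central limit theorem in the form `E exp (m⁻¹ᐟ² ∑ Y i) → exp L`, for commuting, nilpotent,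
centred, independent elements with `E (Y i)² = 2 L` and bounded moments: each factor
`E exp (m⁻¹ᐟ² Y i)` is `1 + L / m + O(m⁻³ᐟ²)`. -/
theorem tendsto_integral_exp_normalized_sum [NormedAlgebra ℝ 𝔸] [CompleteSpace 𝔸]
    [SecondCountableTopology 𝔸] [NormOneClass 𝔸] [IsProbabilityMeasure μ]
    {Y : ℕ → Ω → 𝔸} (hY : ∀ i, Measurable (Y i)) (hindep : iIndepFun Y μ)
    (hcomm : ∀ i j ω ω', Commute (Y i ω) (Y j ω')) {n : ℕ} (hnil : ∀ i ω, Y i ω ^ (n + 3) = 0)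
    {K : ℝ} (hmom : ∀ i, ∀ j < n + 3,
      Integrable (fun ω => ‖Y i ω‖ ^ j) μ ∧ ∫ ω, ‖Y i ω‖ ^ j ∂μ ≤ K)
    (hmean : ∀ i, ∫ ω, Y i ω ∂μ = 0) {L : 𝔸} (hvar : ∀ i, ∫ ω, Y i ω ^ 2 ∂μ = (2 : ℝ) • L) :
    Tendsto (fun m : ℕ => ∫ ω, NormedSpace.exp ((Real.sqrt m)⁻¹ •
      ∑ i ∈ Finset.range m, Y i ω) ∂μ) atTop (𝓝 (NormedSpace.exp L)) := by
  let +nondep : NormedAlgebra ℚ 𝔸 := NormedAlgebra.restrictScalars ℚ ℝ 𝔸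
  have hK0 : 0 ≤ K := le_trans (integral_nonneg fun _ => by positivity) (hmom 0 0 (by omega)).2
  -- `ρ m / m` is the norm of the error of the first order expansion of `exp (L / m)`.
  set ρ : ℕ → ℝ := fun m => (m : ℝ) * ‖NormedSpace.exp ((m : ℝ)⁻¹ • L) - 1 - (m : ℝ)⁻¹ • L‖ with hρ
  have hinv : Tendsto (fun m : ℕ => (m : ℝ)⁻¹) atTop (𝓝 0) := tendsto_inv_atTop_nhds_zero_nat
  have hsq : Tendsto (fun m : ℕ => (Real.sqrt m)⁻¹) atTop (𝓝 0) :=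
    tendsto_inv_atTop_zero.comp (Real.tendsto_sqrt_atTop.comp tendsto_natCast_atTop_atTop)
  have hρ0 : Tendsto ρ atTop (𝓝 0) := by
    have hd := (hasFDerivAt_exp_zero (𝕂 := ℝ) (𝔸 := 𝔸)).isLittleO
    have hL0 : Tendsto (fun m : ℕ => (m : ℝ)⁻¹ • L) atTop (𝓝 0) := by
      simpa using hinv.smul_const L
    have h2 := hd.comp_tendsto hL0
    have h3 : (fun m : ℕ => (m : ℝ)⁻¹ • L - 0) =O[atTop] fun m : ℕ => (m : ℝ)⁻¹ := by
      refine Asymptotics.IsBigO.of_bound ‖L‖ (Eventually.of_forall fun m => ?_)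
      rw [sub_zero, norm_smul, mul_comm]
    have h4 := ((h2.trans_isBigO h3).norm_left).tendsto_div_nhds_zero
    refine h4.congr fun m => ?_
    simp [hρ, div_eq_inv_mul]
  set ε : ℕ → ℝ := fun m => (Real.sqrt m)⁻¹ * (n * K) + ρ m with hε
  have hε0 : Tendsto ε atTop (𝓝 0) := by
    simpa using (hsq.mul_const (n * K : ℝ)).add hρ0
  rw [tendsto_iff_norm_sub_tendsto_zero]
  set c : ℝ := ‖L‖ + n * K with hc
  have hbound : ∀ᶠ m : ℕ in atTop, ‖∫ ω, NormedSpace.exp ((Real.sqrt m)⁻¹ •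
      ∑ i ∈ Finset.range m, Y i ω) ∂μ - NormedSpace.exp L‖ ≤ ε m * Real.exp (c + 1) := by
    filter_upwards [eventually_ge_atTop 1, hρ0.eventually_le_const one_pos] with m hm hρ1
    have hm0 : (0 : ℝ) < m := by exact_mod_cast hm
    set h : ℝ := (Real.sqrt m)⁻¹ with hh
    have h0 : 0 ≤ h := by positivity
    have h1 : h ≤ 1 := inv_le_one_of_one_le₀ (Real.one_le_sqrt.2 (by exact_mod_cast hm))
    have h2 : h ^ 2 = (m : ℝ)⁻¹ := by rw [hh, inv_pow, Real.sq_sqrt hm0.le]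
    have h3 : h ^ 3 = (m : ℝ)⁻¹ * h := by rw [← h2]; ring
    set b := NormedSpace.exp ((m : ℝ)⁻¹ • L) with hb
    set a : ℕ → 𝔸 := fun j => ∫ ω, NormedSpace.exp (h • Y j ω) ∂μ with ha
    have hbm : b ^ m = NormedSpace.exp L := by
      rw [hb, ← NormedSpace.exp_nsmul, ← Nat.cast_smul_eq_nsmul ℝ, smul_smul,
        mul_inv_cancel₀ hm0.ne', one_smul]
    have ha1 (j : ℕ) : ‖a j - (1 + (m : ℝ)⁻¹ • L)‖ ≤ (m : ℝ)⁻¹ * (h * (n * K)) := by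
      have := norm_integral_exp_smul_sub_le (hY j) (hnil j) (hmom j) (hmean j) (hvar j) h0 h1
      rwa [h2, h3, mul_assoc] at this
    have hb1 : ‖b - (1 + (m : ℝ)⁻¹ • L)‖ = (m : ℝ)⁻¹ * ρ m := by
      rw [hρ, inv_mul_cancel_left₀ hm0.ne', sub_add_eq_sub_sub]
    have hlin : ‖(1 : 𝔸) + (m : ℝ)⁻¹ • L‖ ≤ 1 + (m : ℝ)⁻¹ * ‖L‖ := by
      refine (norm_add_le _ _).trans ?_
      rw [norm_one, norm_smul, Real.norm_of_nonneg (by positivity)]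
    -- A common bound of the factors, whose `m`-th power is at most `exp (c + 1)`.
    set R : ℝ := 1 + (c + 1) / m with hR
    have hc0 : 0 ≤ c := by positivity
    have hR1 : 1 ≤ R := le_add_of_nonneg_right (by positivity)
    have hmi : (0 : ℝ) ≤ (m : ℝ)⁻¹ := by positivity
    have hnK : (0 : ℝ) ≤ n * K := by positivity
    have haR (j : ℕ) : ‖a j‖ ≤ R := by
      calc ‖a j‖ = ‖(a j - (1 + (m : ℝ)⁻¹ • L)) + (1 + (m : ℝ)⁻¹ • L)‖ := by rw [sub_add_cancel]
        _ ≤ (m : ℝ)⁻¹ * (h * (n * K)) + (1 + (m : ℝ)⁻¹ * ‖L‖) :=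
          (norm_add_le _ _).trans (add_le_add (ha1 j) hlin)
        _ ≤ (m : ℝ)⁻¹ * (1 * (n * K)) + (1 + (m : ℝ)⁻¹ * ‖L‖) + (m : ℝ)⁻¹ := by
          refine le_add_of_le_of_nonneg ?_ hmi
          gcongr
        _ = R := by rw [hR, hc]; ring
    have hbR : ‖b‖ ≤ R := by
      calc ‖b‖ = ‖(b - (1 + (m : ℝ)⁻¹ • L)) + (1 + (m : ℝ)⁻¹ • L)‖ := by rw [sub_add_cancel]
        _ ≤ (m : ℝ)⁻¹ * ρ m + (1 + (m : ℝ)⁻¹ * ‖L‖) :=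
          (norm_add_le _ _).trans (add_le_add hb1.le hlin)
        _ ≤ (m : ℝ)⁻¹ * 1 + (1 + (m : ℝ)⁻¹ * ‖L‖) + (m : ℝ)⁻¹ * (n * K) := by
          refine le_add_of_le_of_nonneg ?_ (by positivity)
          gcongr
        _ = R := by rw [hR, hc]; ring
    have hρnn : 0 ≤ ρ m := by positivity
    have hεnn : 0 ≤ ε m := by positivity
    have hab (j : ℕ) : ‖a j - b‖ ≤ (m : ℝ)⁻¹ * ε m := by
      calc ‖a j - b‖ = ‖(a j - (1 + (m : ℝ)⁻¹ • L)) - (b - (1 + (m : ℝ)⁻¹ • L))‖ := by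
            rw [sub_sub_sub_cancel_right]
        _ ≤ (m : ℝ)⁻¹ * (h * (n * K)) + (m : ℝ)⁻¹ * ρ m :=
          (norm_sub_le _ _).trans (add_le_add (ha1 j) hb1.le)
        _ = (m : ℝ)⁻¹ * ε m := by rw [hε]; ring
    have hint (i : ℕ) : Integrable (fun ω => NormedSpace.exp (h • Y i ω)) μ :=
      integrable_exp_smul_of_nilpotent (hY i) (hnil i) (fun j hj => (hmom i j hj).1) h
    have key := norm_prod_sub_pow_le (m := m)
      (P := fun j => ∫ ω, NormedSpace.exp (h • ∑ i ∈ Finset.range j, Y i ω) ∂μ) (a := a) (b := b)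
      (by simp) (fun j => (integral_exp_smul_sum_succ hY hindep hcomm hint j).2) hR1
      (by positivity) (fun j _ => hab j) (fun j _ => haR j) hbR
    rw [hbm] at key
    refine key.trans ?_
    have hRm : R ^ m ≤ Real.exp (c + 1) := by
      calc R ^ m ≤ Real.exp ((c + 1) / m) ^ m := by
            refine pow_le_pow_left₀ (by positivity) ?_ m
            rw [hR, add_comm]; exact Real.add_one_le_exp _
        _ = Real.exp (c + 1) := by
            rw [← Real.exp_nat_mul, mul_div_cancel₀ _ hm0.ne']
    rw [mul_inv_cancel_left₀ hm0.ne']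
    gcongr
  refine squeeze_zero' (Eventually.of_forall fun _ => norm_nonneg _) hbound ?_
  simpa using hε0.mul_const (Real.exp (c + 1))

end Integrals

section GenericDeterminant

/-! ### Derivatives of the generic determinant -/

theorem derivation_prod {R ι : Type*} [CommRing R] [Algebra ℝ R] [DecidableEq ι]
    (δ : Derivation ℝ R R) (f : ι → R) (s : Finset ι) :
    δ (∏ i ∈ s, f i) = ∑ i ∈ s, ∏ j ∈ s, Function.update f i (δ (f i)) j := by
  induction s using Finset.induction_on with
  | empty => simp
  | insert a s ha ih =>
    rw [Finset.prod_insert ha, δ.leibniz, ih, Finset.sum_insert ha, Finset.prod_insert ha,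
      Function.update_self, add_comm, smul_eq_mul, smul_eq_mul, mul_comm, Finset.mul_sum]
    congr 1
    · congr 1
      refine Finset.prod_congr rfl fun j hj => ?_
      rw [Function.update_of_ne (by rintro rfl; exact ha hj)]
    · refine Finset.sum_congr rfl fun i hi => ?_
      rw [Finset.prod_insert ha, Function.update_of_ne (by rintro rfl; exact ha hi)]

/-- A derivation acts on a determinant one row at a time. -/
theorem derivation_det {R n : Type*} [CommRing R] [Algebra ℝ R] [DecidableEq n] [Fintype n]
    (δ : Derivation ℝ R R) (G : Matrix n n R) :
    δ G.det = ∑ i, (G.updateRow i fun j => δ (G i j)).det := by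
  have h (H : Matrix n n R) : H.det = ∑ σ : Equiv.Perm n,
      (Equiv.Perm.sign σ : ℤ) • ∏ i, H i (σ i) := by
    rw [← Matrix.det_transpose, Matrix.det_apply]; rfl
  simp_rw [h, map_sum, map_zsmul]
  rw [Finset.sum_comm]
  refine Finset.sum_congr rfl fun σ _ => ?_
  rw [derivation_prod, Finset.smul_sum]
  refine Finset.sum_congr rfl fun i _ => ?_
  congr 1
  refine Finset.prod_congr rfl fun j _ => ?_
  by_cases hj : j = i
  · subst hj; simp
  · simp [hj]

variable {s t k : ℕ}

variable (s t k) in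
/-- The variables of the generic determinant: the entries of the two matrices stacked on top of
each other, and then `x, y, z`. -/
abbrev GenVar : Type := ((Fin s ⊕ Fin t) × Fin k) ⊕ Fin 3

variable (s t k) in
/-- The block matrix `[[x I, -Mᵀ], [M, diag (y, …, y, z, …, z)]]` with generic `M`. -/
noncomputable def genMatrix :
    Matrix (Fin k ⊕ (Fin s ⊕ Fin t)) (Fin k ⊕ (Fin s ⊕ Fin t)) (MvPolynomial (GenVar s t k) ℝ) :=
  Matrix.fromBlocks (Matrix.diagonal fun _ => MvPolynomial.X (Sum.inr 0))
    (Matrix.of fun b a => -MvPolynomial.X (Sum.inl (a, b)))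
    (Matrix.of fun a b => MvPolynomial.X (Sum.inl (a, b)))
    (Matrix.diagonal fun a => MvPolynomial.X (Sum.inr (Sum.elim (fun _ => 1) (fun _ => 2) a)))

variable (s t k) in
/-- The generic determinant, which specializes to `q_{A,B}`. -/
noncomputable def genDet : MvPolynomial (GenVar s t k) ℝ := (genMatrix s t k).det

/-- The minor of the generic determinant in which the rows and the columns of a row index `a` and
of a column index `b` of the generic matrix are removed, written as the determinant with these two
rows replaced by unit vectors. -/
noncomputable def genMinor (a : Fin s ⊕ Fin t) (b : Fin k) : MvPolynomial (GenVar s t k) ℝ :=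
  (((genMatrix s t k).updateRow (Sum.inl b) (Pi.single (Sum.inl b) 1)).updateRow (Sum.inr a)
    (Pi.single (Sum.inr a) 1)).det

theorem det_updateRow_updateRow_swap {R n : Type*} [CommRing R] [DecidableEq n] [Fintype n]
    (G : Matrix n n R) {i j : n} (hij : i ≠ j) (u v : n → R) :
    ((G.updateRow i u).updateRow j v).det = -((G.updateRow i v).updateRow j u).det := by
  have : (G.updateRow i u).updateRow j v =
      ((G.updateRow i v).updateRow j u).submatrix (Equiv.swap i j) id := by
    ext a b
    simp only [Matrix.submatrix_apply, id, Matrix.updateRow_apply]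
    by_cases ha : a = i
    · subst ha; simp [hij]
    by_cases hb : a = j
    · subst hb; simp [hij]
    · simp [Equiv.swap_apply_of_ne_of_ne ha hb, ha, hb]
  rw [this, Matrix.det_permute, Equiv.Perm.sign_swap hij]
  simp

theorem det_updateRow_zero {R n : Type*} [CommRing R] [DecidableEq n] [Fintype n]
    (G : Matrix n n R) (i : n) : (G.updateRow i fun _ => 0).det = 0 :=
  Matrix.det_eq_zero_of_row_eq_zero i fun j => by simp

theorem pderiv_entry_genMatrix (a : Fin s ⊕ Fin t) (b : Fin k) (i : Fin k ⊕ (Fin s ⊕ Fin t)) :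
    (fun j => MvPolynomial.pderiv (Sum.inl (a, b)) (genMatrix s t k i j)) =
      if i = Sum.inr a then Pi.single (Sum.inl b) 1
      else if i = Sum.inl b then -Pi.single (Sum.inr a) 1 else fun _ => 0 := by
  funext j
  rcases i with i | i <;> rcases j with j | j
  · by_cases h : i = j <;> by_cases h' : i = b <;>
      simp [genMatrix, h, h', Matrix.diagonal_apply, MvPolynomial.pderiv_X]
    all_goals split_ifs <;> simp
  · by_cases h : j = a <;> by_cases h' : i = b <;>
      simp [genMatrix, h, h', MvPolynomial.pderiv_X]
  · by_cases h : i = a <;> by_cases h' : j = b <;>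
      simp [genMatrix, h, h', MvPolynomial.pderiv_X]
  · by_cases h : i = j <;> by_cases h' : i = a <;>
      simp [genMatrix, h, h', Matrix.diagonal_apply, MvPolynomial.pderiv_X]
    all_goals split_ifs <;> simp

variable (s t k) in
/-- The index, among `x, y, z`, of the variable in a diagonal entry of `genMatrix`. -/
def diagVar : Fin k ⊕ (Fin s ⊕ Fin t) → Fin 3 :=
  Sum.elim (fun _ => 0) (Sum.elim (fun _ => 1) (fun _ => 2))

theorem pderiv_diag_genMatrix (c : Fin 3) (i : Fin k ⊕ (Fin s ⊕ Fin t)) :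
    (fun j => MvPolynomial.pderiv (Sum.inr c) (genMatrix s t k i j)) =
      if diagVar s t k i = c then Pi.single i 1 else fun _ => 0 := by
  funext j
  by_cases h : j = i
  · subst h
    have : genMatrix s t k j j = MvPolynomial.X (Sum.inr (diagVar s t k j)) := by
      rcases j with j | j | j <;> simp [genMatrix, diagVar]
    rw [this, MvPolynomial.pderiv_X]
    by_cases hc : diagVar s t k j = c
    · subst hc; simp
    · rw [if_neg hc, Pi.single_eq_of_ne (by simpa using hc)]
  · have : MvPolynomial.pderiv (Sum.inr c) (genMatrix s t k i j) = 0 := by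
      rcases i with i | i <;> rcases j with j | j
      · have : i ≠ j := by rintro rfl; exact h rfl
        simp [genMatrix, this]
      · simp [genMatrix, MvPolynomial.pderiv_X]
      · simp [genMatrix, MvPolynomial.pderiv_X]
      · have : i ≠ j := by rintro rfl; exact h rfl
        simp [genMatrix, this]
    rw [this]
    split_ifs <;> simp [h]

/-- The variable of the entry `(a, b)` occurs once in the row of `a` and, with the opposite sign,
once in the row of `b`. The two orders of differentiating these rows give the same minor, whose sign is
positive because its two rows are exchanged. -/
theorem pderiv_sq_entry_genDet (a : Fin s ⊕ Fin t) (b : Fin k) :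
    MvPolynomial.pderiv (Sum.inl (a, b)) (MvPolynomial.pderiv (Sum.inl (a, b)) (genDet s t k)) =
      2 * genMinor a b := by
  set δ := MvPolynomial.pderiv (R := ℝ) (Sum.inl (a, b) : GenVar s t k) with hδ
  set G := genMatrix s t k with hG
  have hpq : (Sum.inr a : Fin k ⊕ (Fin s ⊕ Fin t)) ≠ Sum.inl b := by simp
  -- Only the rows of `a` and of `b` involve the variable.
  have h1 : δ (genDet s t k) = (G.updateRow (Sum.inr a) (Pi.single (Sum.inl b) 1)).det +
      (G.updateRow (Sum.inl b) (-Pi.single (Sum.inr a) 1)).det := by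
    rw [genDet, derivation_det, Finset.sum_eq_add _ _ hpq]
    · rw [pderiv_entry_genMatrix, pderiv_entry_genMatrix, if_pos rfl, if_neg hpq.symm, if_pos rfl]
    · rintro i - ⟨hi, hi'⟩
      rw [pderiv_entry_genMatrix, if_neg hi, if_neg hi', det_updateRow_zero]
    · simp
    · simp
  -- A row that has been differentiated is constant.
  have h2 (p q : Fin k ⊕ (Fin s ⊕ Fin t)) (hpq : p ≠ q) (u v : _ → MvPolynomial (GenVar s t k) ℝ)
      (hu : ∀ j, δ (u j) = 0) (hv : (fun j => δ (G q j)) = v)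
      (h0 : ∀ i, i ≠ p → i ≠ q → (fun j => δ (G i j)) = fun _ => 0) :
      δ (G.updateRow p u).det = ((G.updateRow p u).updateRow q v).det := by
    rw [derivation_det, Finset.sum_eq_single q]
    · congr 2
      rw [← hv]
      funext j
      rw [Matrix.updateRow_ne hpq.symm]
    · rintro i - hi
      by_cases hip : i = p
      · subst hip
        simp only [Matrix.updateRow_self, hu]
        exact det_updateRow_zero _ _
      · simp only [Matrix.updateRow_ne hip]
        rw [h0 i hip hi, det_updateRow_zero]
    · simp
  have hrow (i) (hi : i ≠ Sum.inr a) (hi' : i ≠ Sum.inl b) :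
      (fun j => δ (G i j)) = fun _ => 0 := by
    rw [pderiv_entry_genMatrix, if_neg hi, if_neg hi']
  have hcp (i j : Fin k ⊕ (Fin s ⊕ Fin t)) :
      δ ((Pi.single i 1 : _ → MvPolynomial (GenVar s t k) ℝ) j) = 0 := by
    rw [Pi.single_apply]; split_ifs <;> simp
  rw [h1, map_add, h2 _ _ hpq _ (-Pi.single (Sum.inr a) 1) (hcp _)
      (by rw [pderiv_entry_genMatrix, if_neg hpq.symm, if_pos rfl]) hrow,
    h2 _ _ hpq.symm _ (Pi.single (Sum.inl b) 1)
      (fun j => by rw [Pi.neg_apply, map_neg, hcp, neg_zero])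
      (by rw [pderiv_entry_genMatrix, if_pos rfl]) (fun i hi hi' => hrow i hi' hi)]
  have h3 : ((G.updateRow (Sum.inl b) (-Pi.single (Sum.inr a) 1)).updateRow (Sum.inr a)
      (Pi.single (Sum.inl b) 1)).det = genMinor a b := by
    rw [Matrix.updateRow_comm _ hpq.symm, ← neg_one_smul (MvPolynomial (GenVar s t k) ℝ)
      (Pi.single (Sum.inr a) 1), Matrix.det_updateRow_smul, Matrix.updateRow_comm _ hpq,
      det_updateRow_updateRow_swap _ hpq.symm, genMinor]
    simp [hG]
  rw [Matrix.updateRow_comm _ hpq, h3, two_mul]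

theorem pderiv_pderiv_diag_genDet (c : Fin 3) (hc : c ≠ 0) :
    MvPolynomial.pderiv (Sum.inr 0) (MvPolynomial.pderiv (Sum.inr c) (genDet s t k)) =
      ∑ a, if diagVar s t k (Sum.inr a) = c then ∑ b, genMinor a b else 0 := by
  have h1 : MvPolynomial.pderiv (Sum.inr c) (genDet s t k) =
      ∑ a : Fin s ⊕ Fin t, if diagVar s t k (Sum.inr a) = c then
        ((genMatrix s t k).updateRow (Sum.inr a) (Pi.single (Sum.inr a) 1)).det else 0 := by
    rw [genDet, derivation_det, Fintype.sum_sum_type]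
    simp_rw [pderiv_diag_genMatrix]
    rw [Finset.sum_eq_zero, zero_add]
    · refine Finset.sum_congr rfl fun a _ => ?_
      split_ifs
      · rfl
      · exact det_updateRow_zero _ _
    · intro b _
      rw [if_neg (by simpa [diagVar] using hc.symm), det_updateRow_zero]
  rw [h1, map_sum]
  refine Finset.sum_congr rfl fun a _ => ?_
  split_ifs with h
  · rw [derivation_det, Fintype.sum_sum_type, add_eq_left.2]
    · refine Finset.sum_congr rfl fun b _ => ?_
      simp only [Matrix.updateRow_ne (Sum.inl_ne_inr : (Sum.inl b : Fin k ⊕ _) ≠ Sum.inr a)]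
      rw [pderiv_diag_genMatrix, if_pos (show diagVar s t k (Sum.inl b) = 0 from rfl),
        Matrix.updateRow_comm _ Sum.inr_ne_inl, genMinor]
    · refine Finset.sum_eq_zero fun a' _ => ?_
      by_cases ha : a' = a
      · subst ha
        simp only [Matrix.updateRow_self, Pi.single_apply, apply_ite (MvPolynomial.pderiv _),
          Derivation.map_one_eq_zero, map_zero, ite_self]
        exact det_updateRow_zero _ _
      · have hne : (Sum.inr a' : Fin k ⊕ _) ≠ Sum.inr a := by simpa using ha
        simp only [Matrix.updateRow_ne hne]
        rw [pderiv_diag_genMatrix, if_neg, det_updateRow_zero]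
        rcases a' with a' | a' <;> simp [diagVar]
  · simp

/-! ### Taylor's formula and specialization of the generic matrix -/

theorem commute_pderiv {σ : Type*} (u v : σ) :
    Commute ((MvPolynomial.pderiv (R := ℝ) u).toLinearMap : Module.End ℝ (MvPolynomial σ ℝ))
      (MvPolynomial.pderiv v).toLinearMap := by
  classical
  have h : (⁅MvPolynomial.pderiv (R := ℝ) u, MvPolynomial.pderiv (R := ℝ) v⁆ :
      Derivation ℝ (MvPolynomial σ ℝ) (MvPolynomial σ ℝ)) = 0 := by
    apply MvPolynomial.derivation_ext
    intro w
    rw [Derivation.commutator_apply, MvPolynomial.pderiv_X, MvPolynomial.pderiv_X]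
    simp only [Pi.single_apply, apply_ite (MvPolynomial.pderiv _), Derivation.map_one_eq_zero,
      map_zero, ite_self, sub_zero, Derivation.zero_apply]
  refine LinearMap.ext fun p => ?_
  have := DFunLike.congr_fun h p
  rwa [Derivation.commutator_apply, Derivation.zero_apply, sub_eq_zero] at this

theorem totalDegree_pderiv_le {σ : Type*} (u : σ) (p : MvPolynomial σ ℝ) :
    (MvPolynomial.pderiv u p).totalDegree ≤ p.totalDegree - 1 := by
  classical
  conv_lhs => rw [p.as_sum, map_sum]
  refine MvPolynomial.totalDegree_finsetSum_le fun m hm => ?_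
  rw [MvPolynomial.pderiv_monomial]
  by_cases h0 : m u = 0
  · simp [h0]
  refine (MvPolynomial.totalDegree_monomial_le _ _).trans ?_
  have h1 : (m - Finsupp.single u 1) + Finsupp.single u 1 = m :=
    tsub_add_cancel_of_le (by simpa [Finsupp.single_le_iff] using Nat.one_le_iff_ne_zero.2 h0)
  have h2 : (m - Finsupp.single u 1).degree + 1 = m.degree := by
    conv_rhs => rw [← h1, map_add, Finsupp.degree_single]
  have h3 : m.degree ≤ p.totalDegree := MvPolynomial.le_totalDegree hm
  change (m - Finsupp.single u 1).degree ≤ _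
  omega

/-- Substitution of a real matrix for the generic matrix. -/
noncomputable def subst (M : Matrix (Fin s ⊕ Fin t) (Fin k) ℝ) :
    MvPolynomial (GenVar s t k) ℝ →ₐ[ℝ] MvPolynomial (Fin 3) ℝ :=
  MvPolynomial.aeval (Sum.elim (fun ab => MvPolynomial.C (M ab.1 ab.2)) MvPolynomial.X)

/-- The directional derivative along a real matrix. -/
noncomputable def dirDeriv (M : Matrix (Fin s ⊕ Fin t) (Fin k) ℝ) :
    Derivation ℝ (MvPolynomial (GenVar s t k) ℝ) (MvPolynomial (GenVar s t k) ℝ) :=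
  ∑ ab : (Fin s ⊕ Fin t) × Fin k, M ab.1 ab.2 • MvPolynomial.pderiv (Sum.inl ab)

/-- Substitution of `T M` for the generic matrix, where `T` is a polynomial variable. -/
noncomputable def substLine (M : Matrix (Fin s ⊕ Fin t) (Fin k) ℝ) :
    MvPolynomial (GenVar s t k) ℝ →ₐ[ℝ] Polynomial (MvPolynomial (Fin 3) ℝ) :=
  MvPolynomial.aeval (Sum.elim
    (fun ab => Polynomial.X * Polynomial.C (MvPolynomial.C (M ab.1 ab.2)))
    (fun i => Polynomial.C (MvPolynomial.X i)))

theorem dirDeriv_apply (M : Matrix (Fin s ⊕ Fin t) (Fin k) ℝ) (P : MvPolynomial (GenVar s t k) ℝ) :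
    dirDeriv M P = ∑ ab : (Fin s ⊕ Fin t) × Fin k,
      M ab.1 ab.2 • MvPolynomial.pderiv (Sum.inl ab) P := by
  rw [dirDeriv, ← Derivation.coeFnAddMonoidHom_apply, map_sum, Finset.sum_apply]
  rfl

theorem dirDeriv_X (M : Matrix (Fin s ⊕ Fin t) (Fin k) ℝ) (v : GenVar s t k) :
    dirDeriv M (MvPolynomial.X v) =
      Sum.elim (fun ab => MvPolynomial.C (M ab.1 ab.2)) (fun _ => 0) v := by
  rw [dirDeriv_apply]
  rcases v with v | v
  · rw [Finset.sum_eq_single v]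
    · simp [MvPolynomial.smul_eq_C_mul]
    · intro w _ hw
      rw [MvPolynomial.pderiv_X_of_ne (by simpa using hw.symm), smul_zero]
    · simp
  · exact Finset.sum_eq_zero fun w _ => by
      rw [MvPolynomial.pderiv_X_of_ne (by simp), smul_zero]

theorem derivative_substLine (M : Matrix (Fin s ⊕ Fin t) (Fin k) ℝ)
    (P : MvPolynomial (GenVar s t k) ℝ) :
    Polynomial.derivative (substLine M P) = substLine M (dirDeriv M P) := by
  induction P using MvPolynomial.induction_on with
  | C a =>
    rw [← MvPolynomial.algebraMap_eq, AlgHom.commutes, Derivation.map_algebraMap, map_zero]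
    exact Polynomial.derivative_C
  | add p q hp hq => simp only [map_add, hp, hq]
  | mul_X p v hp =>
    rw [map_mul, Polynomial.derivative_mul, hp, Derivation.leibniz, dirDeriv_X, map_add,
      smul_eq_mul, smul_eq_mul, map_mul, map_mul]
    have hX : Polynomial.derivative (substLine M (MvPolynomial.X v)) = substLine M
        (Sum.elim (fun ab => MvPolynomial.C (M ab.1 ab.2)) (fun _ => 0) v) := by
      rcases v with v | v <;> simp [substLine]
    rw [hX]
    ring

theorem eval_substLine (M : Matrix (Fin s ⊕ Fin t) (Fin k) ℝ) (P : MvPolynomial (GenVar s t k) ℝ) :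
    (substLine M P).eval 1 = subst M P ∧ (substLine M P).eval 0 = subst 0 P := by
  constructor
  · induction P using MvPolynomial.induction_on with
    | C a => simp [substLine, subst]
    | add p q hp hq => simp only [map_add, Polynomial.eval_add, hp, hq]
    | mul_X p v hp =>
      rw [map_mul, Polynomial.eval_mul, hp, map_mul]
      rcases v with v | v <;> simp [substLine, subst]
  · induction P using MvPolynomial.induction_on with
    | C a => simp [substLine, subst]
    | add p q hp hq => simp only [map_add, Polynomial.eval_add, hp, hq]
    | mul_X p v hp =>
      rw [map_mul, Polynomial.eval_mul, hp, map_mul]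
      rcases v with v | v <;> simp [substLine, subst]

/-- Taylor's formula at the zero matrix, obtained by comparing the coefficients of the polynomial
`T ↦ P (T M)` with its iterated derivatives at `T = 0`. -/
theorem subst_eq_sum_dirDeriv (M : Matrix (Fin s ⊕ Fin t) (Fin k) ℝ)
    (P : MvPolynomial (GenVar s t k) ℝ) {n : ℕ}
    (hn : ∀ j, n ≤ j → ((dirDeriv M).toLinearMap ^ j) P = 0) (hn0 : 0 < n) :
    subst M P = ∑ j ∈ Finset.range n,
      ((j.factorial : ℝ)⁻¹) • subst 0 (((dirDeriv M).toLinearMap ^ j) P) := by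
  have hiter (j : ℕ) : Polynomial.derivative^[j] (substLine M P) =
      substLine M (((dirDeriv M).toLinearMap ^ j) P) := by
    induction j with
    | zero => rfl
    | succ j ih =>
      rw [Function.iterate_succ_apply', ih, derivative_substLine, pow_succ', Module.End.mul_apply]
      rfl
  have hcoeff (j : ℕ) : (substLine M P).coeff j =
      ((j.factorial : ℝ)⁻¹) • subst 0 (((dirDeriv M).toLinearMap ^ j) P) := by
    have h := congrArg (Polynomial.eval 0) (hiter j)
    rw [(eval_substLine M _).2, ← Polynomial.coeff_zero_eq_eval_zero,
      Polynomial.coeff_iterate_derivative, zero_add, Nat.descFactorial_self] at h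
    rw [← h, ← Nat.cast_smul_eq_nsmul ℝ, smul_smul,
      inv_mul_cancel₀ (Nat.cast_ne_zero.2 j.factorial_ne_zero), one_smul]
  rw [← (eval_substLine M P).1, Polynomial.eval_eq_sum_range' (n := n)]
  · exact Finset.sum_congr rfl fun j _ => by rw [hcoeff, one_pow, mul_one]
  · have h := Polynomial.natDegree_le_iff_coeff_eq_zero (n := n - 1) (p := substLine M P) |>.2
      fun j hj => by rw [hcoeff, hn j (by omega), map_zero, smul_zero]
    omega

theorem subst_zero_pderiv (i : Fin 3) (P : MvPolynomial (GenVar s t k) ℝ) :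
    subst 0 (MvPolynomial.pderiv (Sum.inr i) P) = MvPolynomial.pderiv i (subst 0 P) := by
  induction P using MvPolynomial.induction_on with
  | C a => simp [subst]
  | add p q hp hq => simp only [map_add, hp, hq]
  | mul_X p v hp =>
    rw [Derivation.leibniz, map_add, smul_eq_mul, smul_eq_mul, map_mul, map_mul, hp, map_mul,
      Derivation.leibniz, smul_eq_mul, smul_eq_mul]
    congr 2
    rcases v with v | v
    · simp [subst, MvPolynomial.pderiv_X]
    · by_cases h : v = i
      · subst h; simp [subst]
      · rw [MvPolynomial.pderiv_X_of_ne (by simpa using h)]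
        simp [subst, MvPolynomial.pderiv_X_of_ne h]

theorem subst_zero_genDet : subst 0 (genDet s t k) =
    MvPolynomial.X 0 ^ k * MvPolynomial.X 1 ^ s * MvPolynomial.X 2 ^ t := by
  have h : (genMatrix s t k).map (subst 0) =
      Matrix.diagonal fun i => MvPolynomial.X (diagVar s t k i) := by
    ext1 i j
    rcases i with i | i | i <;> rcases j with j | j | j <;>
      simp [genMatrix, subst, diagVar, Matrix.diagonal_apply] <;> split_ifs <;> simp
  rw [genDet, AlgHom.map_det, AlgHom.mapMatrix_apply, h, Matrix.det_diagonal]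
  simp [diagVar, mul_assoc]

/-- The generic determinant specializes to `q_{A,B}`. -/
theorem subst_genDet (A : Matrix (Fin s) (Fin k) ℝ) (B : Matrix (Fin t) (Fin k) ℝ) :
    subst (Matrix.fromRows A B) (genDet s t k) = qPoly A B := by
  refine poly_ext fun x y z hy hz => ?_
  have e1 : MvPolynomial.eval ![x, y, z] (subst (Matrix.fromRows A B) (genDet s t k)) =
      Matrix.det (Matrix.fromBlocks
        (x • (1 : Matrix (Fin k) (Fin k) ℝ)) (-(Matrix.fromRows A B).transpose)
        (Matrix.fromRows A B)
        (Matrix.diagonal (Sum.elim (fun _ : Fin s => y) (fun _ : Fin t => z)))) := by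
    rw [genDet, AlgHom.map_det, RingHom.map_det]
    congr 1
    ext (i | i) (j | j)
    · by_cases h : i = j <;> simp [h, genMatrix, subst]
    · simp [genMatrix, subst]
    · simp [genMatrix, subst]
    · by_cases h : i = j
      · subst h; rcases i with i | i <;> simp [genMatrix, subst]
      · simp [h, genMatrix]
  have hinv : Matrix.diagonal (Sum.elim (fun _ : Fin s => y⁻¹) (fun _ : Fin t => z⁻¹)) *
      Matrix.diagonal (Sum.elim (fun _ : Fin s => y) (fun _ : Fin t => z)) = 1 := by
    rw [Matrix.diagonal_mul_diagonal, ← Matrix.diagonal_one]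
    congr 1
    ext (i | i) <;> simp [hy, hz]
  let I : Invertible (Matrix.diagonal (Sum.elim (fun _ : Fin s => y) (fun _ : Fin t => z))) :=
    ⟨_, hinv, mul_eq_one_comm.1 hinv⟩
  have hI : ⅟(Matrix.diagonal (Sum.elim (fun _ : Fin s => y) (fun _ : Fin t => z))) =
    Matrix.diagonal (Sum.elim (fun _ : Fin s => y⁻¹) (fun _ : Fin t => z⁻¹)) := rfl
  -- The Schur complement of the diagonal block is `x I + y⁻¹ AᵀA + z⁻¹ BᵀB`.
  rw [e1, Matrix.det_fromBlocks₂₂, hI, eval_qPoly A B x y z hy hz, eval_pPoly, Matrix.det_diagonal]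
  congr 1
  · simp [Fintype.prod_sum_type]
  · congr 1
    ext i j
    simp only [Matrix.neg_mul, sub_neg_eq_add, one_div, Matrix.add_apply, Matrix.smul_apply,
      Matrix.mul_apply, Fintype.sum_sum_type, Matrix.diagonal_apply, Matrix.transpose_apply,
      Matrix.fromRows_apply_inl, Matrix.fromRows_apply_inr, smul_eq_mul, Finset.mul_sum]
    simp [add_assoc, mul_comm, mul_left_comm, mul_assoc]

theorem totalDegree_genDet_le : (genDet s t k).totalDegree ≤ k + (s + t) := by
  rw [genDet, Matrix.det_apply]
  refine MvPolynomial.totalDegree_finsetSum_le fun σ _ => ?_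
  refine (MvPolynomial.totalDegree_smul_le _ _).trans ?_
  refine (MvPolynomial.totalDegree_finsetProd _ _).trans ?_
  refine (Finset.sum_le_card_nsmul _ _ 1 fun i _ => ?_).trans (by simp)
  generalize σ i = j
  rcases i with i | i <;> rcases j with j | j <;>
      simp [genMatrix, Matrix.diagonal_apply] <;> split_ifs <;> simp

end GenericDeterminant

/-! ### Moments of SPM-bi-invariant matrices -/

section Moments

variable {Ω : Type*} [MeasurableSpace Ω] {μ : Measure Ω} {p k : ℕ}

theorem measurable_entry (a : Fin p) (b : Fin k) :
    Measurable fun M : Matrix (Fin p) (Fin k) ℝ => M a b :=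
  (measurable_pi_apply b).comp (measurable_pi_apply (X := fun _ : Fin p => Fin k → ℝ) a)

theorem signedPerm_mul_apply (ε : Fin p → ℝ) (σ : Equiv.Perm (Fin p))
    (M : Matrix (Fin p) (Fin k) ℝ) (a : Fin p) (b : Fin k) :
    (Matrix.diagonal ε * σ.permMatrix ℝ * M) a b = ε a * M (σ a) b := by
  rw [Matrix.mul_assoc, Matrix.diagonal_mul, Equiv.Perm.permMatrix, PEquiv.toMatrix_toPEquiv_mul]
  rfl

theorem mul_signedPerm_apply (ε : Fin k → ℝ) (σ : Equiv.Perm (Fin k))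
    (M : Matrix (Fin p) (Fin k) ℝ) (a : Fin p) (b : Fin k) :
    (M * (Matrix.diagonal ε * σ.permMatrix ℝ)) a b = M a (σ.symm b) * ε (σ.symm b) := by
  rw [← Matrix.mul_assoc, Equiv.Perm.permMatrix, PEquiv.mul_toMatrix_toPEquiv,
    Matrix.submatrix_apply, Matrix.mul_diagonal]
  rfl

theorem one_or_neg_one_update {n : ℕ} (a i : Fin n) :
    Function.update (fun _ => (1 : ℝ)) a (-1) i = 1 ∨
      Function.update (fun _ => (1 : ℝ)) a (-1) i = -1 := by
  by_cases h : i = a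
  · subst h; simp
  · simp [h]

variable {Y : Ω → Matrix (Fin p) (Fin k) ℝ}

theorem SPMBiInvariant.integral_left (hY : SPMBiInvariant μ Y) (ε : Fin p → ℝ)
    (hε : ∀ i, ε i = 1 ∨ ε i = -1) (σ : Equiv.Perm (Fin p))
    {g : Matrix (Fin p) (Fin k) ℝ → ℝ} (hg : Measurable g) :
    ∫ ω, g (Matrix.diagonal ε * σ.permMatrix ℝ * Y ω) ∂μ = ∫ ω, g (Y ω) ∂μ :=
  ((hY.1 _ ⟨σ, ε, hε, rfl⟩).comp hg).integral_eq

theorem SPMBiInvariant.integral_right (hY : SPMBiInvariant μ Y) (ε : Fin k → ℝ)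
    (hε : ∀ i, ε i = 1 ∨ ε i = -1) (σ : Equiv.Perm (Fin k))
    {g : Matrix (Fin p) (Fin k) ℝ → ℝ} (hg : Measurable g) :
    ∫ ω, g (Y ω * (Matrix.diagonal ε * σ.permMatrix ℝ)) ∂μ = ∫ ω, g (Y ω) ∂μ :=
  ((hY.2 _ ⟨σ, ε, hε, rfl⟩).comp hg).integral_eq

theorem SPMBiInvariant.integral_entry (hY : SPMBiInvariant μ Y) (a : Fin p) (b : Fin k) :
    ∫ ω, Y ω a b ∂μ = 0 := by
  have h := hY.integral_left _ (one_or_neg_one_update a) 1 (measurable_entry a b)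
  simp only [signedPerm_mul_apply, Function.update_self, neg_one_mul, integral_neg,
    Equiv.Perm.one_apply] at h
  linarith

theorem SPMBiInvariant.integral_mul_of_ne (hY : SPMBiInvariant μ Y) {u v : Fin p × Fin k}
    (huv : u ≠ v) : ∫ ω, Y ω u.1 u.2 * Y ω v.1 v.2 ∂μ = 0 := by
  have hg : Measurable fun M : Matrix (Fin p) (Fin k) ℝ => M u.1 u.2 * M v.1 v.2 :=
    (measurable_entry _ _).mul (measurable_entry _ _)
  by_cases h1 : u.1 = v.1
  · have h2 : v.2 ≠ u.2 := fun h2 => huv (Prod.ext h1 h2.symm)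
    have h := hY.integral_right _ (one_or_neg_one_update u.2) (Equiv.refl _) hg
    simp only [mul_signedPerm_apply, Equiv.refl_symm, Equiv.refl_apply,
      Function.update_self, Function.update_of_ne h2, mul_neg_one, mul_one, neg_mul,
      integral_neg] at h
    linarith
  · have h := hY.integral_left _ (one_or_neg_one_update u.1) 1 hg
    simp only [signedPerm_mul_apply, Equiv.Perm.one_apply, Function.update_self,
      Function.update_of_ne (Ne.symm h1), one_mul, neg_mul, integral_neg] at h
    linarith

theorem SPMBiInvariant.integral_sq_eq (hY : SPMBiInvariant μ Y) (u v : Fin p × Fin k) :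
    ∫ ω, Y ω u.1 u.2 * Y ω u.1 u.2 ∂μ = ∫ ω, Y ω v.1 v.2 * Y ω v.1 v.2 ∂μ := by
  have hg (a : Fin p) (b : Fin k) : Measurable fun M : Matrix (Fin p) (Fin k) ℝ => M a b * M a b :=
    (measurable_entry _ _).mul (measurable_entry _ _)
  have h1 := hY.integral_left (fun _ => 1) (fun _ => Or.inl rfl) (Equiv.swap u.1 v.1) (hg u.1 u.2)
  have h2 := hY.integral_right (fun _ => 1) (fun _ => Or.inl rfl) (Equiv.swap u.2 v.2) (hg v.1 u.2)
  simp only [signedPerm_mul_apply, one_mul, Equiv.swap_apply_left] at h1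
  simp only [mul_signedPerm_apply, mul_one, Equiv.symm_swap, Equiv.swap_apply_left] at h2
  rw [← h1, ← h2]

theorem BoundedMoments.integrable_mul {A : ℕ → Ω → Matrix (Fin p) (Fin k) ℝ}
    (hA : BoundedMoments μ A) (hmeas : ∀ i, Measurable (A i)) (i : ℕ) (u v : Fin p × Fin k) :
    Integrable (fun ω => A i ω u.1 u.2 * A i ω v.1 v.2) μ := by
  obtain ⟨M, hM⟩ := hA 2
  refine ((hM i u.1 u.2).1.add (hM i v.1 v.2).1).mono'
    (((measurable_entry _ _).comp (hmeas i)).mul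
      ((measurable_entry _ _).comp (hmeas i))).aestronglyMeasurable (ae_of_all _ fun ω => ?_)
  rw [Real.norm_eq_abs, abs_mul, Pi.add_apply]
  nlinarith [sq_nonneg (|A i ω u.1 u.2| - |A i ω v.1 v.2|), sq_nonneg |A i ω u.1 u.2|,
    sq_nonneg |A i ω v.1 v.2|]

theorem BoundedMoments.integrable_entry {A : ℕ → Ω → Matrix (Fin p) (Fin k) ℝ}
    (hA : BoundedMoments μ A) (hmeas : ∀ i, Measurable (A i)) (i : ℕ) (u : Fin p × Fin k) :
    Integrable (fun ω => A i ω u.1 u.2) μ := by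
  obtain ⟨M, hM⟩ := hA 1
  refine (hM i u.1 u.2).1.mono'
    ((measurable_entry _ _).comp (hmeas i)).aestronglyMeasurable (ae_of_all _ fun ω => ?_)
  simp

/-- Entries of an SPM-bi-invariant matrix are uncorrelated and have the same variance, which the
expected trace of `Y Yᵀ` determines. -/
theorem SPMBiInvariant.integral_mul {A : ℕ → Ω → Matrix (Fin p) (Fin k) ℝ}
    (hA : BoundedMoments μ A) (hmeas : ∀ i, Measurable (A i)) {i : ℕ}
    (hY : SPMBiInvariant μ (A i)) {θ : ℝ}
    (htr : ∫ ω, (A i ω * (A i ω).transpose).trace ∂μ = θ * p * k) (u v : Fin p × Fin k) :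
    ∫ ω, A i ω u.1 u.2 * A i ω v.1 v.2 ∂μ = if u = v then θ else 0 := by
  split_ifs with huv
  · subst huv
    have h : ∫ ω, (A i ω * (A i ω).transpose).trace ∂μ =
        ∑ v : Fin p × Fin k, ∫ ω, A i ω v.1 v.2 * A i ω v.1 v.2 ∂μ := by
      rw [← integral_finsetSum _ fun v _ => hA.integrable_mul hmeas i v v]
      simp [Matrix.trace, Matrix.mul_apply, Fintype.sum_prod_type]
    rw [Finset.sum_congr rfl fun v _ => hY.integral_sq_eq v u, Finset.sum_const, htr] at h
    simp only [Finset.card_univ, Fintype.card_prod, Fintype.card_fin, nsmul_eq_mul] at h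
    have hp : (p : ℝ) ≠ 0 := Nat.cast_ne_zero.2 (by have := u.1.pos; omega)
    have hk : (k : ℝ) ≠ 0 := Nat.cast_ne_zero.2 (by have := u.2.pos; omega)
    push_cast at h
    have : (p * k : ℝ) * (∫ ω, A i ω u.1 u.2 * A i ω u.1 u.2 ∂μ) = p * k * θ := by
      rw [← h]; ring
    exact mul_left_cancel₀ (mul_ne_zero hp hk) this
  · exact hY.integral_mul_of_ne huv

end Moments

/-! ### Sums of random matrices with operator coefficients -/

section Blocks

variable {Ω : Type*} [MeasurableSpace Ω] {μ : Measure Ω} {p k : ℕ}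
  {𝔸 : Type*} [NormedRing 𝔸] [NormedAlgebra ℝ 𝔸]

/-- The linear combination of the operators `D (a, b)` with the entries of a matrix as
coefficients. -/
def blockOp {E : Type*} [AddCommMonoid E] [Module ℝ E] (D : Fin p × Fin k → E)
    (M : Matrix (Fin p) (Fin k) ℝ) : E :=
  ∑ u : Fin p × Fin k, M u.1 u.2 • D u

theorem measurable_blockOp [MeasurableSpace 𝔸] [BorelSpace 𝔸] [SecondCountableTopology 𝔸]
    (D : Fin p × Fin k → 𝔸) : Measurable (blockOp D) :=
  by
  unfold blockOp
  exact Finset.measurable_fun_sum _ fun u _ => (measurable_entry u.1 u.2).smul_const (D u)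

theorem blockOp_normalizedSum {Ω : Type*} (D : Fin p × Fin k → 𝔸)
    (A : ℕ → Ω → Matrix (Fin p) (Fin k) ℝ) (m : ℕ) (ω : Ω) : blockOp D (normalizedSum A m ω) =
      (Real.sqrt m)⁻¹ • ∑ i ∈ Finset.range m, blockOp D (A i ω) := by
  simp only [blockOp, normalizedSum, Matrix.smul_apply, Matrix.sum_apply]
  rw [Finset.sum_comm, Finset.smul_sum]
  refine Finset.sum_congr rfl fun u _ => ?_
  rw [smul_eq_mul, mul_smul, Finset.sum_smul]

theorem commute_blockOp {p' : ℕ} {D : Fin p × Fin k → 𝔸} {D' : Fin p' × Fin k → 𝔸}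
    (hD : ∀ u v, Commute (D u) (D' v)) (M : Matrix (Fin p) (Fin k) ℝ)
    (M' : Matrix (Fin p') (Fin k) ℝ) : Commute (blockOp D M) (blockOp D' M') := by
  unfold blockOp
  exact Commute.sum_left _ _ _ fun u _ => Commute.sum_right _ _ _ fun v _ =>
    ((hD u v).smul_left _).smul_right _

theorem integral_blockOp [CompleteSpace 𝔸] (D : Fin p × Fin k → 𝔸)
    {A : ℕ → Ω → Matrix (Fin p) (Fin k) ℝ} (hA : BoundedMoments μ A)
    (hmeas : ∀ i, Measurable (A i)) (hinv : ∀ i, SPMBiInvariant μ (A i)) (i : ℕ) :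
    ∫ ω, blockOp D (A i ω) ∂μ = 0 := by
  simp only [blockOp]
  rw [integral_finsetSum _ fun u _ => (hA.integrable_entry hmeas i u).smul_const (D u)]
  refine Finset.sum_eq_zero fun u _ => ?_
  rw [integral_smul_const, (hinv i).integral_entry, zero_smul]

theorem integral_blockOp_sq [CompleteSpace 𝔸] (D : Fin p × Fin k → 𝔸)
    {A : ℕ → Ω → Matrix (Fin p) (Fin k) ℝ} (hA : BoundedMoments μ A)
    (hmeas : ∀ i, Measurable (A i)) (hinv : ∀ i, SPMBiInvariant μ (A i)) {θ : ℝ}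
    (htr : ∀ i, ∫ ω, (A i ω * (A i ω).transpose).trace ∂μ = θ * p * k) (i : ℕ) :
    ∫ ω, blockOp D (A i ω) ^ 2 ∂μ = (2 : ℝ) • (θ / 2) • ∑ u, D u ^ 2 := by
  have h (ω : Ω) : blockOp D (A i ω) ^ 2 =
      ∑ u, ∑ v, (A i ω u.1 u.2 * A i ω v.1 v.2) • (D u * D v) := by
    rw [blockOp, sq, Finset.sum_mul_sum]
    simp only [smul_mul_smul_comm]
  have hint (u v : Fin p × Fin k) :
      Integrable (fun ω => (A i ω u.1 u.2 * A i ω v.1 v.2) • (D u * D v)) μ :=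
    (hA.integrable_mul hmeas i u v).smul_const (D u * D v)
  simp_rw [h]
  rw [integral_finsetSum _ fun u _ => integrable_finsetSum _ fun v _ => hint u v, smul_smul,
    mul_div_cancel₀ _ two_ne_zero, Finset.smul_sum]
  refine Finset.sum_congr rfl fun u _ => ?_
  rw [integral_finsetSum _ fun v _ => hint u v]
  simp only [integral_smul_const, (hinv i).integral_mul hA hmeas (htr i), ite_smul, zero_smul,
    Finset.sum_ite_eq, Finset.mem_univ, if_true, sq]

theorem exists_bound_integral_norm_blockOp_pow [MeasurableSpace 𝔸] [BorelSpace 𝔸]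
    [SecondCountableTopology 𝔸] [IsProbabilityMeasure μ] (D : Fin p × Fin k → 𝔸)
    {A : ℕ → Ω → Matrix (Fin p) (Fin k) ℝ} (hA : BoundedMoments μ A)
    (hmeas : ∀ i, Measurable (A i)) (n : ℕ) :
    ∃ K : ℝ, ∀ i, ∀ j < n, Integrable (fun ω => ‖blockOp D (A i ω)‖ ^ j) μ ∧
      ∫ ω, ‖blockOp D (A i ω)‖ ^ j ∂μ ≤ K := by
  have hj (j : ℕ) : ∃ K : ℝ, 0 ≤ K ∧ ∀ i, Integrable (fun ω => ‖blockOp D (A i ω)‖ ^ j) μ ∧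
      ∫ ω, ‖blockOp D (A i ω)‖ ^ j ∂μ ≤ K := by
    rcases j with - | j
    · exact ⟨1, zero_le_one, fun i => by simp⟩
    obtain ⟨M, hM⟩ := hA (j + 1)
    set c : ℝ := (Finset.univ : Finset (Fin p × Fin k)).card ^ j with hc
    have hb (i : ℕ) (ω : Ω) : ‖blockOp D (A i ω)‖ ^ (j + 1) ≤
        c * ∑ u : Fin p × Fin k, |A i ω u.1 u.2| ^ (j + 1) * ‖D u‖ ^ (j + 1) := by
      calc ‖blockOp D (A i ω)‖ ^ (j + 1)
          ≤ (∑ u : Fin p × Fin k, |A i ω u.1 u.2| * ‖D u‖) ^ (j + 1) := by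
            refine pow_le_pow_left₀ (norm_nonneg _) (norm_sum_le_of_le _ fun u _ => ?_) _
            rw [norm_smul, Real.norm_eq_abs]
        _ ≤ c * ∑ u : Fin p × Fin k, (|A i ω u.1 u.2| * ‖D u‖) ^ (j + 1) :=
            pow_sum_le_card_mul_sum_pow (fun u _ => by positivity) j
        _ = _ := by simp only [mul_pow]
    have hI (i : ℕ) : Integrable (fun ω =>
        c * ∑ u : Fin p × Fin k, |A i ω u.1 u.2| ^ (j + 1) * ‖D u‖ ^ (j + 1)) μ :=
      (integrable_finsetSum _ fun u _ => (hM i u.1 u.2).1.mul_const _).const_mul c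
    refine ⟨c * ∑ u : Fin p × Fin k, |M| * ‖D u‖ ^ (j + 1), by positivity, fun i => ?_⟩
    have hI' : Integrable (fun ω => ‖blockOp D (A i ω)‖ ^ (j + 1)) μ := by
      refine (hI i).mono' (((measurable_blockOp D).comp (hmeas i)).norm.pow_const
        (j + 1)).aestronglyMeasurable (ae_of_all _ fun ω => ?_)
      rw [Real.norm_of_nonneg (by positivity)]
      exact hb i ω
    refine ⟨hI', (integral_mono hI' (hI i) (hb i)).trans ?_⟩
    rw [integral_const_mul, integral_finsetSum _ fun u _ => (hM i u.1 u.2).1.mul_const _]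
    simp only [integral_mul_const]
    gcongr with u
    exact (hM i u.1 u.2).2.trans (le_abs_self M)
  choose K hK0 hK using hj
  refine ⟨∑ j ∈ Finset.range n, K j, fun i j hjn => ⟨(hK j i).1, (hK j i).2.trans ?_⟩⟩
  exact Finset.single_le_sum (f := K) (fun j _ => hK0 j) (Finset.mem_range.2 hjn)

end Blocks

/-! ### Two independent sequences -/

section TwoBlocks

variable {Ω : Type*} [MeasurableSpace Ω] {μ : Measure Ω} {s t k : ℕ}

theorem JointlyIndependent.iIndepFun_sumElim {β : Type*} [MeasurableSpace β]
    {A : ℕ → Ω → Matrix (Fin s) (Fin k) ℝ} {B : ℕ → Ω → Matrix (Fin t) (Fin k) ℝ}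
    (h : JointlyIndependent μ A B) {f : Matrix (Fin s) (Fin k) ℝ → β} (hf : Measurable f)
    {g : Matrix (Fin t) (Fin k) ℝ → β} (hg : Measurable g) :
    iIndepFun (Sum.elim (fun i ω => f (A i ω)) (fun i ω => g (B i ω)) : ℕ ⊕ ℕ → Ω → β) μ := by
  refine iIndep_of_iIndep_of_le h ?_
  rintro (i | i)
  · exact (MeasurableSpace.comap_comp (f := f) (g := A i)).symm.trans_le
      (MeasurableSpace.comap_mono hf.comap_le)
  · exact (MeasurableSpace.comap_comp (f := g) (g := B i)).symm.trans_le
      (MeasurableSpace.comap_mono hg.comap_le)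

theorem indepFun_sum_inl_sum_inr {β : Type*} [AddCommMonoid β] [MeasurableSpace β]
    [MeasurableAdd₂ β] {Z : ℕ ⊕ ℕ → Ω → β} (hZ : iIndepFun Z μ) (hmeas : ∀ i, Measurable (Z i))
    (m : ℕ) : IndepFun (fun ω => ∑ i ∈ Finset.range m, Z (Sum.inl i) ω)
      (fun ω => ∑ i ∈ Finset.range m, Z (Sum.inr i) ω) μ := by
  set S : Finset (ℕ ⊕ ℕ) := (Finset.range m).map Function.Embedding.inl
  set T : Finset (ℕ ⊕ ℕ) := (Finset.range m).map Function.Embedding.inr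
  have hST : Disjoint S T := Finset.disjoint_map_inl_map_inr _ _
  have hsum (U : Finset (ℕ ⊕ ℕ)) : Measurable fun x : U → β => ∑ i, x i :=
    Finset.measurable_fun_sum _ fun i _ => measurable_pi_apply i
  have h := (hZ.indepFun_finset S T hST hmeas).comp (hsum S) (hsum T)
  have hS (ω : Ω) : ∑ i : S, Z i ω = ∑ i ∈ Finset.range m, Z (Sum.inl i) ω := by
    rw [Finset.sum_coe_sort S fun i => Z i ω, Finset.sum_map]; rfl
  have hT (ω : Ω) : ∑ i : T, Z i ω = ∑ i ∈ Finset.range m, Z (Sum.inr i) ω := by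
    rw [Finset.sum_coe_sort T fun i => Z i ω, Finset.sum_map]; rfl
  simpa only [Function.comp_def, hS, hT] using h

/-- The limit theorem for two sequences at once: by independence and commutativity the expectation
factors into the contributions of the matrices `A i` and of the matrices `B i`. -/
theorem tendsto_integral_exp_blockOp_add [IsProbabilityMeasure μ]
    {𝔸 : Type*} [NormedRing 𝔸] [NormedAlgebra ℝ 𝔸] [NormOneClass 𝔸] [CompleteSpace 𝔸]
    [MeasurableSpace 𝔸] [BorelSpace 𝔸] [SecondCountableTopology 𝔸]
    {A : ℕ → Ω → Matrix (Fin s) (Fin k) ℝ} {B : ℕ → Ω → Matrix (Fin t) (Fin k) ℝ} {θ₁ θ₂ : ℝ}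
    (hAmeas : ∀ i, Measurable (A i)) (hBmeas : ∀ i, Measurable (B i))
    (hindep : JointlyIndependent μ A B)
    (hAinv : ∀ i, SPMBiInvariant μ (A i)) (hBinv : ∀ i, SPMBiInvariant μ (B i))
    (hAmom : BoundedMoments μ A) (hBmom : BoundedMoments μ B)
    (hAtr : ∀ i, ∫ ω, (A i ω * (A i ω).transpose).trace ∂μ = θ₁ * s * k)
    (hBtr : ∀ i, ∫ ω, (B i ω * (B i ω).transpose).trace ∂μ = θ₂ * t * k)
    {D : Fin s × Fin k → 𝔸} {D' : Fin t × Fin k → 𝔸}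
    (hD : ∀ u v, Commute (D u) (D v)) (hD' : ∀ u v, Commute (D' u) (D' v))
    (hDD' : ∀ u v, Commute (D u) (D' v)) {n : ℕ}
    (hnil : ∀ M, blockOp D M ^ (n + 3) = 0) (hnil' : ∀ M, blockOp D' M ^ (n + 3) = 0) :
    (∀ m, Integrable (fun ω => NormedSpace.exp
      (blockOp D (normalizedSum A m ω) + blockOp D' (normalizedSum B m ω))) μ) ∧
    Tendsto (fun m => ∫ ω, NormedSpace.exp
      (blockOp D (normalizedSum A m ω) + blockOp D' (normalizedSum B m ω)) ∂μ) atTop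
      (𝓝 (NormedSpace.exp ((θ₁ / 2) • ∑ u, D u ^ 2 + (θ₂ / 2) • ∑ u, D' u ^ 2))) := by
  let +nondep : NormedAlgebra ℚ 𝔸 := NormedAlgebra.restrictScalars ℚ ℝ 𝔸
  have hYm (i : ℕ) : Measurable fun ω => blockOp D (A i ω) := (measurable_blockOp D).comp (hAmeas i)
  have hYm' (i : ℕ) : Measurable fun ω => blockOp D' (B i ω) :=
    (measurable_blockOp D').comp (hBmeas i)
  have hZ := hindep.iIndepFun_sumElim (measurable_blockOp D) (measurable_blockOp D')
  have hYind : iIndepFun (fun i ω => blockOp D (A i ω)) μ := hZ.precomp Sum.inl_injective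
  have hYind' : iIndepFun (fun i ω => blockOp D' (B i ω)) μ := hZ.precomp Sum.inr_injective
  obtain ⟨K, hK⟩ := exists_bound_integral_norm_blockOp_pow D hAmom hAmeas (n + 3)
  obtain ⟨K', hK'⟩ := exists_bound_integral_norm_blockOp_pow D' hBmom hBmeas (n + 3)
  have hYc (i j : ℕ) (ω ω' : Ω) := commute_blockOp hD (A i ω) (A j ω')
  have hYc' (i j : ℕ) (ω ω' : Ω) := commute_blockOp hD' (B i ω) (B j ω')
  have hI (m : ℕ) := (integral_exp_smul_sum_succ hYm hYind hYc (h := (Real.sqrt m)⁻¹) (fun i =>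
    integrable_exp_smul_of_nilpotent (hYm i) (fun ω => hnil _) (fun j hj => (hK i j hj).1) _) m).1
  have hI' (m : ℕ) := (integral_exp_smul_sum_succ hYm' hYind' hYc' (h := (Real.sqrt m)⁻¹) (fun i =>
    integrable_exp_smul_of_nilpotent (hYm' i) (fun ω => hnil' _)
      (fun j hj => (hK' i j hj).1) _) m).1
  have hlim := tendsto_integral_exp_normalized_sum hYm hYind hYc (fun i ω => hnil _) hK
    (integral_blockOp D hAmom hAmeas hAinv) (integral_blockOp_sq D hAmom hAmeas hAinv hAtr)
  have hlim' := tendsto_integral_exp_normalized_sum hYm' hYind' hYc' (fun i ω => hnil' _) hK'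
    (integral_blockOp D' hBmom hBmeas hBinv) (integral_blockOp_sq D' hBmom hBmeas hBinv hBtr)
  have hexp (h : ℝ) : Measurable fun a : 𝔸 => NormedSpace.exp (h • a) :=
    (NormedSpace.exp_continuous.comp (continuous_const_smul h)).measurable
  have hprod (m : ℕ) := integrable_mul_and_integral_mul_of_indepFun
    ((indepFun_sum_inl_sum_inr hZ (by rintro (i | i); exacts [hYm i, hYm' i]) m).comp
      (hexp (Real.sqrt m)⁻¹) (hexp (Real.sqrt m)⁻¹)) (hI m) (hI' m)
  have he (m : ℕ) (ω : Ω) : NormedSpace.exp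
      (blockOp D (normalizedSum A m ω) + blockOp D' (normalizedSum B m ω)) =
      NormedSpace.exp ((Real.sqrt m)⁻¹ • ∑ i ∈ Finset.range m, blockOp D (A i ω)) *
      NormedSpace.exp ((Real.sqrt m)⁻¹ • ∑ i ∈ Finset.range m, blockOp D' (B i ω)) := by
    rw [NormedSpace.exp_add_of_commute (commute_blockOp hDD' _ _), blockOp_normalizedSum,
      blockOp_normalizedSum]
  simp only [he]
  refine ⟨fun m => (hprod m).1, ?_⟩
  rw [NormedSpace.exp_add_of_commute]
  · exact (hlim.mul hlim').congr fun m => (hprod m).2.symm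
  · exact ((Commute.sum_left _ _ _ fun u _ => Commute.sum_right _ _ _ fun v _ =>
      (hDD' u v).pow_pow 2 2).smul_left _).smul_right _

/-- The same limit for commuting nilpotent endomorphisms of a finite-dimensional space, tested
against a vector and a linear functional. -/
theorem tendsto_integral_apply_exp_blockOp_add [IsProbabilityMeasure μ]
    {V : Type*} [AddCommGroup V] [Module ℝ V] [FiniteDimensional ℝ V] [Nontrivial V]
    {A : ℕ → Ω → Matrix (Fin s) (Fin k) ℝ} {B : ℕ → Ω → Matrix (Fin t) (Fin k) ℝ} {θ₁ θ₂ : ℝ}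
    (hAmeas : ∀ i, Measurable (A i)) (hBmeas : ∀ i, Measurable (B i))
    (hindep : JointlyIndependent μ A B)
    (hAinv : ∀ i, SPMBiInvariant μ (A i)) (hBinv : ∀ i, SPMBiInvariant μ (B i))
    (hAmom : BoundedMoments μ A) (hBmom : BoundedMoments μ B)
    (hAtr : ∀ i, ∫ ω, (A i ω * (A i ω).transpose).trace ∂μ = θ₁ * s * k)
    (hBtr : ∀ i, ∫ ω, (B i ω * (B i ω).transpose).trace ∂μ = θ₂ * t * k)
    {D : Fin s × Fin k → Module.End ℝ V} {D' : Fin t × Fin k → Module.End ℝ V}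
    (hD : ∀ u v, Commute (D u) (D v)) (hD' : ∀ u v, Commute (D' u) (D' v))
    (hDD' : ∀ u v, Commute (D u) (D' v)) {n : ℕ}
    (hnil : ∀ M M', (blockOp D M + blockOp D' M') ^ (n + 3) = 0)
    (hL : ((θ₁ / 2) • ∑ u, D u ^ 2 + (θ₂ / 2) • ∑ u, D' u ^ 2) ^ (n + 3) = 0)
    (x : V) (l : V →ₗ[ℝ] ℝ) :
    (∀ m, Integrable (fun ω => l (∑ j ∈ Finset.range (n + 3), ((j.factorial : ℝ)⁻¹) •
      ((blockOp D (normalizedSum A m ω) + blockOp D' (normalizedSum B m ω)) ^ j) x)) μ) ∧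
    Tendsto (fun m => ∫ ω, l (∑ j ∈ Finset.range (n + 3), ((j.factorial : ℝ)⁻¹) •
      ((blockOp D (normalizedSum A m ω) + blockOp D' (normalizedSum B m ω)) ^ j) x) ∂μ) atTop
      (𝓝 (l (∑ j ∈ Finset.range (n + 3), ((j.factorial : ℝ)⁻¹) •
        (((θ₁ / 2) • ∑ u, D u ^ 2 + (θ₂ / 2) • ∑ u, D' u ^ 2) ^ j) x))) := by
  -- Any norm will do, as all norms on a finite-dimensional space are equivalent.
  let e : V ≃ₗ[ℝ] (Fin (Module.finrank ℝ V) → ℝ) := (Module.finBasis ℝ V).equivFun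
  let : NormedAddCommGroup V := NormedAddCommGroup.induced V _ e.toLinearMap e.injective
  let : NormedSpace ℝ V := NormedSpace.induced ℝ V _ e.toLinearMap
  have : CompleteSpace V := FiniteDimensional.complete ℝ V
  have : ProperSpace (V →L[ℝ] V) := FiniteDimensional.proper ℝ _
  let T : Module.End ℝ V →ₐ[ℝ] (V →L[ℝ] V) :=
    AlgHom.ofLinearMap (LinearMap.toContinuousLinearMap (E := V) (F' := V)).toLinearMap rfl
      fun _ _ => rfl
  have hT {p : ℕ} (D : Fin p × Fin k → Module.End ℝ V) (M : Matrix (Fin p) (Fin k) ℝ) :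
      blockOp (fun u => T (D u)) M = T (blockOp D M) := by
    simp only [blockOp, map_sum, map_smul]
  let ev : (V →L[ℝ] V) →L[ℝ] ℝ :=
    (LinearMap.toContinuousLinearMap l).comp (ContinuousLinearMap.apply ℝ V x)
  have hev (a : Module.End ℝ V) (ha : a ^ (n + 3) = 0) : ev (NormedSpace.exp (T a)) =
      l (∑ j ∈ Finset.range (n + 3), ((j.factorial : ℝ)⁻¹) • (a ^ j) x) := by
    rw [exp_eq_sum_of_pow_eq_zero (n := n + 3) (by rw [← map_pow, ha, map_zero])]
    simp only [← map_pow, ← map_smul, ← map_sum]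
    change l ((∑ j ∈ Finset.range (n + 3), ((j.factorial : ℝ)⁻¹) • a ^ j) x) = _
    simp
  have h0 {p : ℕ} (D : Fin p × Fin k → Module.End ℝ V) : blockOp D 0 = 0 := by simp [blockOp]
  have key := tendsto_integral_exp_blockOp_add hAmeas hBmeas hindep hAinv hBinv hAmom hBmom hAtr
    hBtr (D := fun u => T (D u)) (D' := fun u => T (D' u)) (fun u v => (hD u v).map T)
    (fun u v => (hD' u v).map T) (fun u v => (hDD' u v).map T) (n := n)
    (fun M => by rw [hT, ← map_pow, ← add_zero (blockOp D M), ← h0 D', hnil, map_zero])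
    (fun M => by rw [hT, ← map_pow, ← zero_add (blockOp D' M), ← h0 D, hnil, map_zero])
  simp only [hT, ← map_pow, ← map_sum, ← map_smul, ← map_add] at key
  have hev' (M M') := hev (blockOp D M + blockOp D' M') (hnil M M')
  simp only [← hev', ← hev _ hL]
  refine ⟨fun m => ev.integrable_comp (key.1 m), ?_⟩
  simp only [fun m => ev.integral_comp_comm (key.1 m)]
  exact (ev.continuous.tendsto _).comp key.2

end TwoBlocks

variable {s t k : ℕ}

/-! ### Operators that lower the degree -/

/-- A linear operator on polynomials that kills constants and otherwise lowers the total degree. -/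
def LowersDegree {σ : Type*} (T : Module.End ℝ (MvPolynomial σ ℝ)) : Prop :=
  ∀ p, (T p).totalDegree ≤ p.totalDegree - 1 ∧ (p.totalDegree = 0 → T p = 0)

namespace LowersDegree

variable {σ : Type*} {T T' : Module.End ℝ (MvPolynomial σ ℝ)}

theorem pderiv (u : σ) : LowersDegree (MvPolynomial.pderiv (R := ℝ) u).toLinearMap := by
  refine fun p => ⟨totalDegree_pderiv_le u p, fun h => ?_⟩
  rw [MvPolynomial.totalDegree_eq_zero_iff_eq_C.1 h]
  exact MvPolynomial.pderiv_C

theorem add (h : LowersDegree T) (h' : LowersDegree T') : LowersDegree (T + T') := fun p =>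
  ⟨(MvPolynomial.totalDegree_add _ _).trans (max_le (h p).1 (h' p).1), fun hp => by
    rw [LinearMap.add_apply, (h p).2 hp, (h' p).2 hp, add_zero]⟩

theorem smul (c : ℝ) (h : LowersDegree T) : LowersDegree (c • T) := fun p =>
  ⟨(MvPolynomial.totalDegree_smul_le _ _).trans (h p).1, fun hp => by
    rw [LinearMap.smul_apply, (h p).2 hp, smul_zero]⟩

theorem sum {ι : Type*} (S : Finset ι) {T : ι → Module.End ℝ (MvPolynomial σ ℝ)}
    (h : ∀ i, LowersDegree (T i)) : LowersDegree (∑ i ∈ S, T i) := by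
  classical
  induction S using Finset.induction_on with
  | empty => exact fun p => by simp
  | insert a S ha ih => rw [Finset.sum_insert ha]; exact (h a).add ih

theorem sq (h : LowersDegree T) : LowersDegree (T ^ 2) := fun p => by
  rw [pow_two, Module.End.mul_apply]
  refine ⟨(h _).1.trans ((Nat.sub_le _ _).trans (h p).1), fun hp => ?_⟩
  rw [(h p).2 hp, map_zero]

theorem pow_apply_eq_zero (h : LowersDegree T) {n : ℕ} {p : MvPolynomial σ ℝ}
    (hp : p.totalDegree < n) : (T ^ n) p = 0 := by
  induction n generalizing p with
  | zero => omega
  | succ n ih =>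
    rw [pow_succ, Module.End.mul_apply]
    rcases Nat.eq_zero_or_pos p.totalDegree with h0 | h0
    · rw [(h p).2 h0, map_zero]
    · exact ih (by have := (h p).1; omega)

theorem mapsTo (h : LowersDegree T) (d : ℕ) :
    ∀ p ∈ MvPolynomial.restrictTotalDegree σ ℝ d, T p ∈ MvPolynomial.restrictTotalDegree σ ℝ d := by
  intro p hp
  rw [MvPolynomial.mem_restrictTotalDegree] at hp ⊢
  have := (h p).1
  omega

theorem restrict_pow_eq_zero (h : LowersDegree T) {d n : ℕ} (hn : d < n) :
    (T.restrict (h.mapsTo d)) ^ n = 0 := by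
  rw [Module.End.pow_restrict]
  refine LinearMap.ext fun p => Subtype.ext ?_
  have hp := (MvPolynomial.mem_restrictTotalDegree _ _ _).1 p.2
  exact h.pow_apply_eq_zero (hp.trans_lt hn)

end LowersDegree

/-! ### The heat operator on the generic determinant -/

/-- The partial derivative in a variable, as a linear operator. -/
noncomputable abbrev pd {σ : Type*} (v : σ) : Module.End ℝ (MvPolynomial σ ℝ) :=
  (MvPolynomial.pderiv v).toLinearMap

variable (s t k) in
/-- The weighted Laplace operator in the entries of the two generic matrices. -/
noncomputable def entryLaplacian (θ₁ θ₂ : ℝ) : Module.End ℝ (MvPolynomial (GenVar s t k) ℝ) :=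
  (θ₁ / 2) • ∑ u : Fin s × Fin k, pd (Sum.inl (Sum.inl u.1, u.2)) ^ 2 +
    (θ₂ / 2) • ∑ u : Fin t × Fin k, pd (Sum.inl (Sum.inr u.1, u.2)) ^ 2

variable (s t k) in
/-- The operator `θ₁ ∂x ∂y + θ₂ ∂x ∂z` on polynomials in the entries and in `x, y, z`. -/
noncomputable def genDiffOp (θ₁ θ₂ : ℝ) : Module.End ℝ (MvPolynomial (GenVar s t k) ℝ) :=
  θ₁ • (pd (Sum.inr 0) * pd (Sum.inr 1)) + θ₂ • (pd (Sum.inr 0) * pd (Sum.inr 2))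

theorem lowersDegree_entryLaplacian (θ₁ θ₂ : ℝ) : LowersDegree (entryLaplacian s t k θ₁ θ₂) :=
  ((LowersDegree.sum _ fun _ => (LowersDegree.pderiv _).sq).smul _).add
    ((LowersDegree.sum _ fun _ => (LowersDegree.pderiv _).sq).smul _)

theorem commute_entryLaplacian_genDiffOp (θ₁ θ₂ : ℝ) :
    Commute (entryLaplacian s t k θ₁ θ₂) (genDiffOp s t k θ₁ θ₂) := by
  have h (u v w : GenVar s t k) : Commute (pd u ^ 2) (pd v * pd w) :=
    ((commute_pderiv u v).mul_right (commute_pderiv u w)).pow_left 2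
  have h1 {ι : Type} [Fintype ι] (f : ι → GenVar s t k) (c : ℝ) :
      Commute (c • ∑ i, pd (f i) ^ 2) (genDiffOp s t k θ₁ θ₂) :=
    (Commute.sum_left _ _ _ fun i _ =>
      ((h _ _ _).smul_right _).add_right ((h _ _ _).smul_right _)).smul_left _
  exact (h1 _ _).add_left (h1 _ _)

/-- The heat equation: on the generic determinant, the Laplace operator in the entries acts as
`θ₁ ∂x ∂y + θ₂ ∂x ∂z`, as both produce the sum of the same minors. -/
theorem entryLaplacian_genDet (θ₁ θ₂ : ℝ) :
    entryLaplacian s t k θ₁ θ₂ (genDet s t k) = genDiffOp s t k θ₁ θ₂ (genDet s t k) := by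
  have h (a : Fin s ⊕ Fin t) (b : Fin k) :
      (pd (Sum.inl (a, b)) ^ 2) (genDet s t k) = (2 : ℝ) • genMinor a b := by
    rw [pow_two, Module.End.mul_apply, MvPolynomial.smul_eq_C_mul, map_ofNat]
    exact pderiv_sq_entry_genDet a b
  have h1 : pd (Sum.inr 0) (pd (Sum.inr 1) (genDet s t k)) =
      ∑ u : Fin s × Fin k, genMinor (Sum.inl u.1) u.2 := by
    refine (pderiv_pderiv_diag_genDet 1 (by decide)).trans ?_
    simp [Fintype.sum_sum_type, Fintype.sum_prod_type, diagVar]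
  have h2 : pd (Sum.inr 0) (pd (Sum.inr 2) (genDet s t k)) =
      ∑ u : Fin t × Fin k, genMinor (Sum.inr u.1) u.2 := by
    refine (pderiv_pderiv_diag_genDet 2 (by decide)).trans ?_
    simp [Fintype.sum_sum_type, Fintype.sum_prod_type, diagVar]
  simp only [entryLaplacian, genDiffOp, LinearMap.add_apply, LinearMap.smul_apply,
    LinearMap.sum_apply, Module.End.mul_apply, h, h1, h2, ← Finset.smul_sum, smul_smul,
    div_mul_cancel₀ _ (two_ne_zero' ℝ)]

theorem entryLaplacian_pow_genDet (θ₁ θ₂ : ℝ) (j : ℕ) :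
    (entryLaplacian s t k θ₁ θ₂ ^ j) (genDet s t k) =
      (genDiffOp s t k θ₁ θ₂ ^ j) (genDet s t k) := by
  induction j with
  | zero => rfl
  | succ j ih =>
    rw [pow_succ, Module.End.mul_apply, entryLaplacian_genDet, ← Module.End.mul_apply,
      ((commute_entryLaplacian_genDiffOp θ₁ θ₂).pow_left j).eq, Module.End.mul_apply, ih,
      ← Module.End.mul_apply, ← pow_succ']

theorem subst_zero_genDiffOp (θ₁ θ₂ : ℝ) (P : MvPolynomial (GenVar s t k) ℝ) :
    subst 0 (genDiffOp s t k θ₁ θ₂ P) = diffOp θ₁ θ₂ (subst 0 P) := by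
  have h (c : Fin 3) : subst 0 (pd (Sum.inr 0) (pd (Sum.inr c) P)) = pd 0 (pd c (subst 0 P)) :=
    (subst_zero_pderiv 0 _).trans (congrArg _ (subst_zero_pderiv c P))
  simp only [genDiffOp, diffOp, LinearMap.add_apply, LinearMap.smul_apply, Module.End.mul_apply,
    map_add, map_smul, h]

theorem subst_zero_entryLaplacian_pow (θ₁ θ₂ : ℝ) (j : ℕ) :
    subst 0 ((entryLaplacian s t k θ₁ θ₂ ^ j) (genDet s t k)) = (diffOp θ₁ θ₂ ^ j)
      (MvPolynomial.X 0 ^ k * MvPolynomial.X 1 ^ s * MvPolynomial.X 2 ^ t) := by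
  rw [entryLaplacian_pow_genDet]
  induction j with
  | zero => exact subst_zero_genDet
  | succ j ih =>
    rw [pow_succ', Module.End.mul_apply, subst_zero_genDiffOp, ih, pow_succ', Module.End.mul_apply]

/-- The limit polynomial is the value at the zero matrices of the heat flow started from the generic
determinant. -/
theorem limitPoly_eq_sum (θ₁ θ₂ : ℝ) {n : ℕ} (hn : k + (s + t) < n) :
    limitPoly s t k θ₁ θ₂ = ∑ j ∈ Finset.range n, ((j.factorial : ℝ)⁻¹) •
      subst 0 ((entryLaplacian s t k θ₁ θ₂ ^ j) (genDet s t k)) := by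
  simp only [subst_zero_entryLaplacian_pow]
  refine finsum_eq_sum_of_support_subset _ fun j hj => ?_
  by_contra hc
  apply hj
  simp only [Finset.coe_range, Set.mem_Iio, not_lt] at hc
  have hdeg := totalDegree_genDet_le (s := s) (t := t) (k := k)
  beta_reduce
  rw [← subst_zero_entryLaplacian_pow, (lowersDegree_entryLaplacian θ₁ θ₂).pow_apply_eq_zero
    (by omega), map_zero, smul_zero]

/-! ### The expected polynomial -/

theorem blockOp_add_blockOp_eq_dirDeriv (M : Matrix (Fin s) (Fin k) ℝ)
    (M' : Matrix (Fin t) (Fin k) ℝ) :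
    blockOp (fun u => pd (Sum.inl (Sum.inl u.1, u.2) : GenVar s t k)) M +
      blockOp (fun u => pd (Sum.inl (Sum.inr u.1, u.2) : GenVar s t k)) M' =
      (dirDeriv (Matrix.fromRows M M')).toLinearMap := by
  refine LinearMap.ext fun P => ?_
  refine Eq.trans ?_ (dirDeriv_apply (Matrix.fromRows M M') P).symm
  simp [blockOp, Fintype.sum_prod_type, Fintype.sum_sum_type]

/-- Coefficients and values at points are both linear functionals, so that the two modes of
convergence are instances of this one. -/
theorem tendsto_integral_linear_qSum {Ω : Type*} [MeasurableSpace Ω] {μ : Measure Ω}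
    [IsProbabilityMeasure μ] {θ₁ θ₂ : ℝ}
    {A : ℕ → Ω → Matrix (Fin s) (Fin k) ℝ} {B : ℕ → Ω → Matrix (Fin t) (Fin k) ℝ}
    (hAmeas : ∀ i, Measurable (A i)) (hBmeas : ∀ i, Measurable (B i))
    (hindep : JointlyIndependent μ A B)
    (hAinv : ∀ i, SPMBiInvariant μ (A i)) (hBinv : ∀ i, SPMBiInvariant μ (B i))
    (hAmom : BoundedMoments μ A) (hBmom : BoundedMoments μ B)
    (hAtr : ∀ i, ∫ ω, (A i ω * (A i ω).transpose).trace ∂μ = θ₁ * s * k)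
    (hBtr : ∀ i, ∫ ω, (B i ω * (B i ω).transpose).trace ∂μ = θ₂ * t * k)
    (l : MvPolynomial (Fin 3) ℝ →ₗ[ℝ] ℝ) :
    (∀ m, Integrable (fun ω => l (qSum A B m ω)) μ) ∧
      Tendsto (fun m => ∫ ω, l (qSum A B m ω) ∂μ) atTop (𝓝 (l (limitPoly s t k θ₁ θ₂))) := by
  set d := k + (s + t) with hd
  have hpd (v : GenVar s t k) := LowersDegree.pderiv v
  let V := MvPolynomial.restrictTotalDegree (GenVar s t k) ℝ d
  have : Nontrivial V := by
    refine ⟨⟨0, ⟨1, (MvPolynomial.mem_restrictTotalDegree _ _ _).2 (by simp)⟩, fun h => ?_⟩⟩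
    exact zero_ne_one (congrArg Subtype.val h)
  let DV (v : GenVar s t k) : Module.End ℝ V := (pd v).restrict ((hpd v).mapsTo d)
  have hDV (u v : GenVar s t k) : Commute (DV u) (DV v) :=
    LinearMap.ext fun p => Subtype.ext (LinearMap.congr_fun (commute_pderiv u v) p)
  let x : V := ⟨genDet s t k, (MvPolynomial.mem_restrictTotalDegree _ _ _).2 totalDegree_genDet_le⟩
  let l' : V →ₗ[ℝ] ℝ := l ∘ₗ (subst 0).toLinearMap ∘ₗ V.subtype
  have hN (M : Matrix (Fin s) (Fin k) ℝ) (M' : Matrix (Fin t) (Fin k) ℝ) :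
      LowersDegree (dirDeriv (Matrix.fromRows M M')).toLinearMap := by
    rw [← blockOp_add_blockOp_eq_dirDeriv]
    exact (LowersDegree.sum _ fun _ => (hpd _).smul _).add
      (LowersDegree.sum _ fun _ => (hpd _).smul _)
  have hNV (M : Matrix (Fin s) (Fin k) ℝ) (M' : Matrix (Fin t) (Fin k) ℝ) :
      blockOp (fun u => DV (Sum.inl (Sum.inl u.1, u.2))) M +
        blockOp (fun u => DV (Sum.inl (Sum.inr u.1, u.2))) M' =
      (dirDeriv (Matrix.fromRows M M')).toLinearMap.restrict ((hN M M').mapsTo d) := by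
    refine LinearMap.ext fun p => Subtype.ext ?_
    rw [LinearMap.coe_restrict_apply, ← blockOp_add_blockOp_eq_dirDeriv]
    simp [blockOp, DV]
  have hLV : (θ₁ / 2) • ∑ u : Fin s × Fin k, DV (Sum.inl (Sum.inl u.1, u.2)) ^ 2 +
        (θ₂ / 2) • ∑ u : Fin t × Fin k, DV (Sum.inl (Sum.inr u.1, u.2)) ^ 2 =
      (entryLaplacian s t k θ₁ θ₂).restrict ((lowersDegree_entryLaplacian θ₁ θ₂).mapsTo d) := by
    refine LinearMap.ext fun p => Subtype.ext ?_
    rw [LinearMap.coe_restrict_apply]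
    simp [entryLaplacian, DV, pow_two]
  have hl (T : Module.End ℝ (MvPolynomial (GenVar s t k) ℝ)) (hT : LowersDegree T) (j : ℕ) :
      l' ((T.restrict (hT.mapsTo d) ^ j) x) = l (subst 0 ((T ^ j) (genDet s t k))) := by
    rw [Module.End.pow_restrict]; rfl
  have key := tendsto_integral_apply_exp_blockOp_add hAmeas hBmeas hindep hAinv hBinv hAmom hBmom
    hAtr hBtr (D := fun u => DV (Sum.inl (Sum.inl u.1, u.2)))
    (D' := fun u => DV (Sum.inl (Sum.inr u.1, u.2))) (fun u v => hDV _ _) (fun u v => hDV _ _)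
    (fun u v => hDV _ _) (n := d)
    (fun M M' => by rw [hNV]; exact (hN M M').restrict_pow_eq_zero (by omega))
    (by rw [hLV]; exact (lowersDegree_entryLaplacian θ₁ θ₂).restrict_pow_eq_zero (by omega)) x l'
  simp only [hNV, hLV, map_sum, map_smul, hl _ (hN _ _),
    hl _ (lowersDegree_entryLaplacian θ₁ θ₂)] at key
  have hq (m : ℕ) (ω : Ω) : l (qSum A B m ω) = ∑ j ∈ Finset.range (d + 3),
      ((j.factorial : ℝ)⁻¹) • l (subst 0 (((dirDeriv (Matrix.fromRows (normalizedSum A m ω)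
        (normalizedSum B m ω))).toLinearMap ^ j) (genDet s t k))) := by
    rw [qSum, ← subst_genDet, subst_eq_sum_dirDeriv _ _ (n := d + 3) _ (by omega), map_sum]
    · simp only [map_smul]
    · exact fun j hj => (hN _ _).pow_apply_eq_zero (by
        have := totalDegree_genDet_le (s := s) (t := t) (k := k); omega)
  have hlim : l (limitPoly s t k θ₁ θ₂) = ∑ j ∈ Finset.range (d + 3), ((j.factorial : ℝ)⁻¹) •
      l (subst 0 ((entryLaplacian s t k θ₁ θ₂ ^ j) (genDet s t k))) := by
    rw [limitPoly_eq_sum θ₁ θ₂ (n := d + 3) (by omega), map_sum]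
    simp only [map_smul]
  simp only [hq, hlim]
  exact key

end SPMCLT

theorem mainTheorem6 {Ω : Type*} [MeasurableSpace Ω] (μ : Measure Ω) [IsProbabilityMeasure μ]
    (s t k : ℕ) (θ₁ θ₂ : ℝ)
    (A : ℕ → Ω → Matrix (Fin s) (Fin k) ℝ) (B : ℕ → Ω → Matrix (Fin t) (Fin k) ℝ)
    (hAmeas : ∀ i, Measurable (A i)) (hBmeas : ∀ i, Measurable (B i))
    (hindep : SPMCLT.JointlyIndependent μ A B)
    (hAinv : ∀ i, SPMCLT.SPMBiInvariant μ (A i))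
    (hBinv : ∀ i, SPMCLT.SPMBiInvariant μ (B i))
    (hAmom : SPMCLT.BoundedMoments μ A) (hBmom : SPMCLT.BoundedMoments μ B)
    (hAtr : ∀ i, ∫ ω, (A i ω * (A i ω).transpose).trace ∂μ = θ₁ * s * k)
    (hBtr : ∀ i, ∫ ω, (B i ω * (B i ω).transpose).trace ∂μ = θ₂ * t * k) :
    -- convergence of the expected polynomials coefficient by coefficient
    (∀ e : Fin 3 →₀ ℕ, (∀ m, Integrable (fun ω => (SPMCLT.qSum A B m ω).coeff e) μ) ∧
      Tendsto (fun m : ℕ => ∫ ω, (SPMCLT.qSum A B m ω).coeff e ∂μ) atTop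
        (𝓝 ((SPMCLT.limitPoly s t k θ₁ θ₂).coeff e))) ∧
    -- and at every point
    (∀ x y z : ℝ, (∀ m, Integrable (fun ω => MvPolynomial.eval ![x, y, z] (SPMCLT.qSum A B m ω)) μ) ∧
      Tendsto (fun m : ℕ => ∫ ω, MvPolynomial.eval ![x, y, z] (SPMCLT.qSum A B m ω) ∂μ) atTop
        (𝓝 (MvPolynomial.eval ![x, y, z] (SPMCLT.limitPoly s t k θ₁ θ₂)))) := by
  have key := fun l => SPMCLT.tendsto_integral_linear_qSum hAmeas hBmeas hindep hAinv hBinv hAmom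
    hBmom hAtr hBtr l
  exact ⟨fun e => key (MvPolynomial.lcoeff ℝ e), fun x y z =>
    key (MvPolynomial.aeval ![x, y, z]).toLinearMap⟩
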